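/- **Conventions.** An *algebraic type* $\sigma$ is a set of finitary operators together with a set of identities; $\sigma$-alg denotes the category of (small) sets with operators satisfying the identities. We suppose that $\sigma$ has a *multiplicative monoid structure*: a derived binary operator and a derived constant which make every $\sigma$-algebra a commutative monoid. For a multiplicative submonoid $S$ of a $\sigma$-algebra $R$, $R_S$ is the $\sigma$-algebra obtained from $R$ by universally inverting the elements of $S$, and $R_s=R_{\{1,s,s^2,\dots\}}$. *PIIRng* is the category of commutative semirings in which $a+a=a$, $1+a=1$ and $aa=a$ for all $a$, ordered by $a\le b\iff a+b=b$; localization along submonoids exists in it as well. **Schematizable algebraic types.** A *schematizable algebraic type* $\mathscr A=(\sigma,\alpha_1,\alpha_2,\gamma)$ consists of an algebraic type $\sigma$ with a multiplicative monoid structure, a functor $\alpha_1:\sigma\text{-alg}\to\text{PIIRng}$, monoid homomorphisms $\alpha_2:R\to(\alpha_1(R),\cdot)$ natural in $R$, and isomorphisms $\gamma:\alpha_1(R)_{\alpha_2(S)}\simeq\alpha_1(R_S)$ natural in the pair $(R,S)$, where a homomorphism of pairs $(A,S)\to(B,T)$ is a homomorphism $f:A\to B$ with $f(S)\subset T$.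 It satisfies the *weak patching condition* if for every $\sigma$-algebra $R$ (i) $\alpha_2(R)$ generates $\alpha_1(R)$ as a semiring; (ii) whenever $n\ge1$, $s_1,\dots,s_n\in R$ and $\alpha_2(s_1)+\dots+\alpha_2(s_n)=1$, and $a_i\in R_{s_i}$ are such that $a_i$ and $a_j$ have the same image in $R_{s_is_j}$ for all $i,j$, there is a unique $a\in R$ whose image in $R_{s_i}$ is $a_i$ for all $i$. **Sheaves.** An *algebraic sober space* is a spectral space: a quasi-compact sober space in which the quasi-compact open sets form a basis and are stable under finite intersections. For such $X$, let $C(X)_{\rm cpt}$ be the object of PIIRng whose elements are the closed sets with quasi-compact complement, with $Z+W=Z\cap W$ and $ZW=Z\cup W$; thus $0=X$, $1=\emptyset$, and $Z\le W\iff Z\supset W$. A presheaf on $C(X)_{\rm cpt}$ is a contravariant functor on this ordered set. It is a *sheaf* if $F(0)$ is terminal and $F(Z_1+Z_2)=F(Z_1)\times_{F(Z_1Z_2)}F(Z_2)$ for all $Z_1,Z_2$. The presheaf $\tau'_X:Z\mapsto (C(X)_{\rm cpt})_Z$ (localization along $\{1,Z,Z^2,\dots\}$) is a PIIRng-valued sheaf.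 **$\mathscr A$-schemes.** An *$\mathscr A$-scheme* $(X,\mathcal O_X,\beta_X)$ is an algebraic sober space $X$ with a $\sigma$-alg-valued sheaf $\mathcal O_X$ on $C(X)_{\rm cpt}$ and a morphism $\beta_X:\alpha_1\mathcal O_X\to\tau'_X$, where $\alpha_1\mathcal O_X$ is the sheafification of $Z\mapsto\alpha_1(\mathcal O_X(Z))$ (equivalently, $\beta_X$ is a morphism of presheaves from $Z\mapsto\alpha_1(\mathcal O_X(Z))$ to $\tau'_X$), such that *restrictions reflect localization*: if $W\le Z$ and $a\in\mathcal O_X(Z)$ satisfy $\beta_X(\alpha_2(a))\ge W$ in $\tau'_X(Z)$, then $\mathcal O_X(Z)\to\mathcal O_X(W)$ factors through $\mathcal O_X(Z)_a$. A *morphism* $X\to Y$ is a pair $(f,f^\#)$ of a quasi-compact continuous map $f:X\to Y$ and a morphism of sheaves $f^\#:\mathcal O_Y\to f_*\mathcal O_X$ such that $f_*\beta_X\circ\alpha_1f^\#=C(f)_{\rm cpt}\circ\beta_Y$, where $C(f)_{\rm cpt}:\tau'_Y\to f_*\tau'_X$ is induced by $Z\mapsto f^{-1}(Z)$. Let $\mathscr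 A$-Sch be the category of $\mathscr A$-schemes, and $\Gamma:(\mathscr A\text{-Sch})^{\rm op}\to\sigma\text{-alg}$, $\Gamma(X)=\mathcal O_X(1)$, the global section functor. **The spectrum functor.** Suppose that $\mathscr A$ satisfies the weak patching condition. For a $\sigma$-algebra $R$, let $X$ be the set of prime ideals of the semiring $\alpha_1(R)$ with its Zariski topology, with the closed sets $V(d)=\{\mathfrak p\mid d\in\mathfrak p\}$, $d\in\alpha_1(R)$; these are exactly the elements of $C(X)_{\rm cpt}$. Let $\mathcal O_X$ be the sheafification of $\mathcal O'_X:Z\mapsto R_{S(Z)}$, $S(Z)=\{x\in R\mid V(\alpha_2(x))\ge Z\}$, and let $\beta_X$ be the morphism induced by $$\alpha_1(R_{S(Z)})\xrightarrow{\ \gamma^{-1}\ }\alpha_1(R)_{\alpha_2(S(Z))}\xrightarrow{\ d\mapsto V(d)\ }(C(X)_{\rm cpt})_Z=\tau'_X(Z).$$ Then $\operatorname{Spec}^{\mathscr A}R=(X,\mathcal O_X,\beta_X)$ is an $\mathscr A$-scheme. A homomorphism $\varphi:B\to A$ induces the map $f:\mathfrak p\mapsto\alpha_1(\varphi)^{-1}(\mathfrak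 p)$ and, through the homomorphisms $B_{S(Z)}\to A_{S(f^{-1}Z)}$, the morphism $f^\#$; this defines a functor $\operatorname{Spec}^{\mathscr A}:\sigma\text{-alg}\to(\mathscr A\text{-Sch})^{\rm op}$. **Theorem.** Let $\mathscr A=(\sigma,\alpha_1,\alpha_2,\gamma)$ be a schematizable algebraic type satisfying the weak patching condition. Then the spectrum functor $\operatorname{Spec}^{\mathscr A}:\sigma\text{-alg}\to(\mathscr A\text{-Sch})^{\rm op}$ is left adjoint to the global section functor $\Gamma:(\mathscr A\text{-Sch})^{\rm op}\to\sigma\text{-alg}$. -/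

import Mathlib

open CategoryTheory Opposite

universe u v w

noncomputable section

namespace SigmaScheme

/-! ### Algebraic types and their algebras -/

/-- A set of finitary operators. -/
structure OpSet : Type (u + 1) where
  /-- the operators -/
  Op : Type u
  /-- the number of arguments of an operator -/
  arity : Op → ℕ

/-- The derived operators (terms) with variables in `V`: the closure of the variables under
the operators. -/
inductive Term (Ω : OpSet.{u}) (V : Type v) : Type (max u v)
  | var : V → Term Ω V
  | app : ∀ ω : Ω.Op, (Fin (Ω.arity ω) → Term Ω V) → Term Ω V

namespace Term

variable {Ω : OpSet.{u}} {V : Type v}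

/-- The value of a term, when the operators act on `A` by `op` and the variables are assigned
the values `x`. -/
def eval {A : Type w} (op : ∀ ω : Ω.Op, (Fin (Ω.arity ω) → A) → A) (x : V → A) : Term Ω V → A
  | var i => x i
  | app ω t => op ω fun i => (t i).eval op x

theorem map_eval {A B : Type*} {op : ∀ ω : Ω.Op, (Fin (Ω.arity ω) → A) → A}
    {op' : ∀ ω : Ω.Op, (Fin (Ω.arity ω) → B) → B} {f : A → B}
    (hf : ∀ ω x, f (op ω x) = op' ω fun i => f (x i)) (x : V → A) (t : Term Ω V) :
    f (t.eval op x) = t.eval op' fun i => f (x i) := by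
  induction t with
  | var i => rfl
  | app ω t ih => simp only [Term.eval, hf, ih]

end Term

/-- An algebraic type `⟨Ω, E⟩`: a set `Ω` of finitary operators and a set `E` of identities. An
identity is a pair of terms in countably many variables. -/
structure AlgType : Type (u + 1) extends OpSet.{u} where
  /-- the identities -/
  E : Set (Term toOpSet ℕ × Term toOpSet ℕ)

/-- A `σ`-algebra: a set with an action of the operators that satisfies the identities. -/
structure Alg (σ : AlgType.{u}) : Type (u + 1) where
  /-- the underlying set -/
  carrier : Type u
  /-- the action of the operators -/
  op : ∀ ω : σ.Op, (Fin (σ.arity ω) → carrier) → carrier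
  ident : ∀ e ∈ σ.E, ∀ x : ℕ → carrier, e.1.eval op x = e.2.eval op x

/-- A homomorphism of `σ`-algebras. -/
@[ext]
structure AlgHom {σ : AlgType.{u}} (A B : Alg σ) : Type u where
  /-- the underlying map -/
  toFun : A.carrier → B.carrier
  map_op : ∀ ω x, toFun (A.op ω x) = B.op ω fun i => toFun (x i)

/-- The category of `σ`-algebras. -/
instance (σ : AlgType.{u}) : Category.{u} (Alg σ) where
  Hom A B := AlgHom A B
  id A := ⟨fun x => x, fun _ _ => rfl⟩
  comp f g := ⟨fun x => g.toFun (f.toFun x), fun ω x => by rw [f.map_op, g.map_op]⟩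

namespace Alg

variable {σ : AlgType.{u}}

instance (A B : Alg σ) : CoeFun (A ⟶ B) (fun _ => A.carrier → B.carrier) :=
  ⟨fun f => AlgHom.toFun f⟩

theorem hom_ext {A B : Alg σ} {f g : A ⟶ B} (h : ∀ x, f x = g x) : f = g :=
  AlgHom.ext (funext h)

@[simp] theorem id_apply (A : Alg σ) (x : A.carrier) : (𝟙 A : A ⟶ A) x = x := rfl

@[simp] theorem comp_apply {A B C : Alg σ} (f : A ⟶ B) (g : B ⟶ C) (x : A.carrier) :
    (f ≫ g) x = g (f x) := rfl

theorem map_op {A B : Alg σ} (f : A ⟶ B) (ω : σ.Op) (x : Fin (σ.arity ω) → A.carrier) :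
    f (A.op ω x) = B.op ω fun i => f (x i) := AlgHom.map_op f ω x

theorem map_eval {A B : Alg σ} (f : A ⟶ B) {V : Type v} (x : V → A.carrier)
    (t : Term σ.toOpSet V) : f (t.eval A.op x) = t.eval B.op fun i => f (x i) :=
  Term.map_eval (AlgHom.map_op f) x t

end Alg

/-- An algebraic type with a multiplicative monoid structure: a derived binary operator and a
derived constant, which form a commutative monoid in every algebra. -/
structure MonAlgType : Type (u + 1) extends AlgType.{u} where
  /-- the multiplication -/
  mulTerm : Term toOpSet (Fin 2)
  /-- the unit -/
  oneTerm : Term toOpSet (Fin 0)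
  mul_assoc : ∀ (A : Alg toAlgType) (x y z : A.carrier),
    mulTerm.eval A.op ![mulTerm.eval A.op ![x, y], z] =
      mulTerm.eval A.op ![x, mulTerm.eval A.op ![y, z]]
  mul_comm : ∀ (A : Alg toAlgType) (x y : A.carrier),
    mulTerm.eval A.op ![x, y] = mulTerm.eval A.op ![y, x]
  one_mul : ∀ (A : Alg toAlgType) (x : A.carrier),
    mulTerm.eval A.op ![oneTerm.eval A.op ![], x] = x

variable {σ : MonAlgType.{u}}

/-- The underlying multiplicative monoid of a `σ`-algebra. -/
instance (A : Alg σ.toAlgType) : CommMonoid A.carrier where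
  mul x y := σ.mulTerm.eval A.op ![x, y]
  one := σ.oneTerm.eval A.op ![]
  mul_assoc := σ.mul_assoc A
  mul_comm := σ.mul_comm A
  one_mul := σ.one_mul A
  mul_one x := (σ.mul_comm A _ _).trans (σ.one_mul A x)

namespace Alg

theorem mul_def {A : Alg σ.toAlgType} (x y : A.carrier) :
    x * y = σ.mulTerm.eval A.op ![x, y] := rfl

theorem one_def {A : Alg σ.toAlgType} : (1 : A.carrier) = σ.oneTerm.eval A.op ![] := rfl

/-- A homomorphism of `σ`-algebras is a homomorphism of the underlying monoids. -/
def toMonoidHom {A B : Alg σ.toAlgType} (f : A ⟶ B) : A.carrier →* B.carrier where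
  toFun x := f x
  map_one' := by
    simp only [one_def, map_eval]
    congr 1
    funext i
    exact i.elim0
  map_mul' x y := by
    simp only [mul_def, map_eval]
    congr 1
    funext i
    fin_cases i <;> rfl

@[simp] theorem toMonoidHom_apply {A B : Alg σ.toAlgType} (f : A ⟶ B) (x : A.carrier) :
    toMonoidHom f x = f x := rfl

end Alg

/-! ### Localization of `σ`-algebras -/

namespace Loc

variable (R : Alg σ.toAlgType) (S : Submonoid R.carrier)

/-- Terms in the elements of `R` and in formal inverses of the elements of `S`. -/
abbrev Pre : Type u := Term σ.toOpSet (R.carrier ⊕ S)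

variable {R S}

/-- The congruence that defines the localization: it is generated by the identities of `σ`, by the
operators of `R`, and by the relations saying that the formal inverse of `s` is inverse to `s`. -/
inductive Rel : Pre R S → Pre R S → Prop
  | refl (t) : Rel t t
  | symm {t t'} : Rel t t' → Rel t' t
  | trans {t t' t''} : Rel t t' → Rel t' t'' → Rel t t''
  | congr (ω : σ.Op) {t t' : Fin (σ.arity ω) → Pre R S} :
      (∀ i, Rel (t i) (t' i)) → Rel (Term.app ω t) (Term.app ω t')
  | ident (e) (he : e ∈ σ.E) (x : ℕ → Pre R S) :
      Rel (e.1.eval Term.app x) (e.2.eval Term.app x)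
  | op (ω : σ.Op) (a : Fin (σ.arity ω) → R.carrier) :
      Rel (Term.app ω fun i => Term.var (Sum.inl (a i))) (Term.var (Sum.inl (R.op ω a)))
  | inv (s : S) :
      Rel (σ.mulTerm.eval Term.app ![Term.var (Sum.inl s.1), Term.var (Sum.inr s)])
        (σ.oneTerm.eval Term.app ![])

variable (R S) in
/-- The congruence as a setoid. -/
def setoid : Setoid (Pre R S) := ⟨Rel, Rel.refl, Rel.symm, Rel.trans⟩

/-- The operators on the quotient. -/
def quotOp (ω : σ.Op) (x : Fin (σ.arity ω) → Quotient (setoid R S)) : Quotient (setoid R S) :=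
  Quotient.mk _ (Term.app ω fun i => (x i).out)

theorem quotOp_mk (ω : σ.Op) (t : Fin (σ.arity ω) → Pre R S) :
    quotOp ω (fun i => Quotient.mk (setoid R S) (t i)) = Quotient.mk _ (Term.app ω t) :=
  Quotient.sound (Rel.congr ω fun i =>
    Quotient.exact (s := setoid R S) (Quotient.out_eq (Quotient.mk (setoid R S) (t i))))

theorem eval_mk {V : Type v} (x : V → Pre R S) (t : Term σ.toOpSet V) :
    t.eval quotOp (fun i => Quotient.mk (setoid R S) (x i)) =
      Quotient.mk _ (t.eval Term.app x) := by
  induction t with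
  | var i => rfl
  | app ω t ih => simp only [Term.eval, ih, quotOp_mk]

end Loc

/-- The localization `R_S` of a `σ`-algebra `R` along a submonoid `S`. -/
def Loc (R : Alg σ.toAlgType) (S : Submonoid R.carrier) : Alg σ.toAlgType where
  carrier := Quotient (Loc.setoid R S)
  op := Loc.quotOp
  ident e he x := by
    have hx : x = fun i => Quotient.mk (Loc.setoid R S) (x i).out :=
      funext fun i => (Quotient.out_eq _).symm
    rw [hx, Loc.eval_mk, Loc.eval_mk]
    exact Quotient.sound (Loc.Rel.ident e he _)

namespace Loc

variable {R : Alg σ.toAlgType} {S : Submonoid R.carrier}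

variable (R S) in
/-- The localization map `R ⟶ R_S`. -/
def ι : R ⟶ Loc R S where
  toFun a := Quotient.mk _ (Term.var (Sum.inl a))
  map_op ω a := by
    refine (Quotient.sound (Rel.symm (Rel.op ω a))).trans ?_
    exact (quotOp_mk ω _).symm

/-- The inverse of `s` in `R_S`. -/
def inv (s : S) : (Loc R S).carrier := Quotient.mk _ (Term.var (Sum.inr s))

theorem ι_mul_inv (s : S) : ι R S s.1 * inv s = 1 := by
  have h1 : ι R S s.1 * inv s = σ.mulTerm.eval quotOp
      (fun i => Quotient.mk (setoid R S) (![Term.var (Sum.inl s.1), Term.var (Sum.inr s)] i)) := by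
    rw [Alg.mul_def]
    change σ.mulTerm.eval quotOp _ = _
    congr 1
    funext i
    fin_cases i <;> rfl
  have h2 : (1 : (Loc R S).carrier) = σ.oneTerm.eval quotOp
      (fun i => Quotient.mk (setoid R S) ((![] : Fin 0 → Pre R S) i)) := by
    rw [Alg.one_def]
    change σ.oneTerm.eval quotOp _ = _
    congr 1
    funext i
    exact i.elim0
  rw [h1, h2, eval_mk, eval_mk]
  exact Quotient.sound (Rel.inv s)

theorem isUnit_ι {s : R.carrier} (hs : s ∈ S) : IsUnit (ι R S s) :=
  IsUnit.of_mul_eq_one (inv ⟨s, hs⟩) (ι_mul_inv ⟨s, hs⟩)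

/-- Two homomorphisms out of `R_S` that agree on `R` are equal. -/
theorem hom_ext {B : Alg σ.toAlgType} {f g : Loc R S ⟶ B} (h : ∀ a, f (ι R S a) = g (ι R S a)) :
    f = g := by
  have hinv : ∀ s : S, f (inv s) = g (inv s) := fun s => by
    have hf : f (ι R S s.1) * f (inv s) = 1 := by
      have := congrArg (Alg.toMonoidHom f) (ι_mul_inv s)
      rwa [map_mul, map_one] at this
    have hg : f (ι R S s.1) * g (inv s) = 1 := by
      have := congrArg (Alg.toMonoidHom g) (ι_mul_inv s)
      rw [map_mul, map_one] at this
      rw [h]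
      exact this
    calc f (inv s) = f (inv s) * (f (ι R S s.1) * g (inv s)) := by rw [hg, mul_one]
      _ = g (inv s) := by rw [← mul_assoc, mul_comm (f (inv s)), hf, one_mul]
  refine Alg.hom_ext fun x => ?_
  induction x using Quotient.inductionOn with
  | h t =>
    induction t with
    | var i =>
      cases i with
      | inl a => exact h a
      | inr s => exact hinv s
    | app ω t ih =>
      have e : (Quotient.mk (setoid R S) (Term.app ω t)) =
          (Loc R S).op ω fun i => Quotient.mk (setoid R S) (t i) := (quotOp_mk ω t).symm
      refine (congrArg f.toFun e).trans (Eq.trans ?_ (congrArg g.toFun e).symm)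
      refine (Alg.map_op f ω _).trans (Eq.trans ?_ (Alg.map_op g ω _).symm)
      exact congrArg _ (funext ih)

section lift

variable {B : Alg σ.toAlgType} (f : R ⟶ B) (hf : ∀ s ∈ S, IsUnit (f s))

/-- The values of the variables in the definition of `lift`. -/
def liftVar : R.carrier ⊕ S → B.carrier
  | Sum.inl a => f a
  | Sum.inr s => ((hf s.1 s.2).unit⁻¹ : B.carrierˣ)

theorem liftVar_rel {t t' : Pre R S} (h : Rel t t') :
    t.eval B.op (liftVar f hf) = t'.eval B.op (liftVar f hf) := by
  have key : ∀ {V : Type} (x : V → Pre R S) (t : Term σ.toOpSet V),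
      (t.eval Term.app x).eval B.op (liftVar f hf) =
        t.eval B.op fun i => (x i).eval B.op (liftVar f hf) := by
    intro V x t
    induction t with
    | var i => rfl
    | app ω t ih => simp only [Term.eval, ih]
  induction h with
  | refl t => rfl
  | symm _ ih => exact ih.symm
  | trans _ _ ih ih' => exact ih.trans ih'
  | congr ω _ ih =>
    simp only [Term.eval]
    exact congrArg _ (funext ih)
  | ident e he x =>
    rw [key, key]
    exact B.ident e he _
  | op ω a =>
    simp only [Term.eval, liftVar]
    exact (Alg.map_op f ω a).symm
  | inv s =>
    rw [key, key]
    have h1 : f s.1 * ((hf s.1 s.2).unit⁻¹ : B.carrierˣ) = 1 := (hf s.1 s.2).mul_val_inv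
    rw [Alg.mul_def, Alg.one_def] at h1
    convert h1 using 2
    funext i
    fin_cases i <;> rfl

/-- The universal property of the localization. -/
def lift : Loc R S ⟶ B where
  toFun := Quotient.lift (fun t : Pre R S => t.eval B.op (liftVar f hf))
    fun _ _ h => liftVar_rel f hf h
  map_op ω x := by
    have hx : x = fun i => Quotient.mk (setoid R S) (x i).out :=
      funext fun i => (Quotient.out_eq _).symm
    rw [hx]
    refine (congrArg _ (quotOp_mk ω fun i => (x i).out)).trans ?_
    rfl

@[simp] theorem lift_ι (a : R.carrier) : lift f hf (ι R S a) = f a := rfl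

end lift

section map

variable {A B C : Alg σ.toAlgType} {S : Submonoid A.carrier} {T : Submonoid B.carrier}
  {U : Submonoid C.carrier}

/-- The homomorphism `A_S ⟶ B_T` induced by a homomorphism `f : A ⟶ B` with `f(S) ⊆ T`. -/
def map (f : A ⟶ B) (h : ∀ s ∈ S, f s ∈ T) : Loc A S ⟶ Loc B T :=
  lift (f ≫ ι B T) fun s hs => isUnit_ι (h s hs)

@[simp] theorem map_ι (f : A ⟶ B) (h : ∀ s ∈ S, f s ∈ T) (a : A.carrier) :
    map f h (ι A S a) = ι B T (f a) := rfl

theorem map_comp (f : A ⟶ B) (h : ∀ s ∈ S, f s ∈ T) (g : B ⟶ C) (h' : ∀ s ∈ T, g s ∈ U)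
    (h'' : ∀ s ∈ S, (f ≫ g) s ∈ U) : map f h ≫ map g h' = map (f ≫ g) h'' :=
  hom_ext fun _ => rfl

theorem map_id (h : ∀ s ∈ S, (𝟙 A : A ⟶ A) s ∈ S) : map (𝟙 A) h = 𝟙 (Loc A S) :=
  hom_ext fun _ => rfl

end map

/-- For `S ⊆ T`, the canonical homomorphism `R_S ⟶ R_T`. -/
def res {T : Submonoid R.carrier} (h : S ≤ T) : Loc R S ⟶ Loc R T := map (𝟙 R) h

end Loc

/-! ### Pre-complete idealic semirings with idempotent multiplication -/

/-- A commutative semiring is a pre-complete idealic semiring with idempotent multiplication if its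
addition is idempotent, its unit is absorbing for the addition, and its multiplication is
idempotent. The order is `a ≤ b ↔ a + b = b`; then `0` is minimal, `1` is maximal, `a + b` is the
supremum and `a * b` the infimum of `a` and `b` (so binary infimums need not be required). -/
class IsPIIRng (D : Type u) [CommSemiring D] : Prop where
  add_self : ∀ a : D, a + a = a
  one_add : ∀ a : D, 1 + a = 1
  mul_self : ∀ a : D, a * a = a

namespace IsPIIRng

/-- The order `a ≤ b ↔ a + b = b` of an idempotent semiring. -/
def LE {D : Type u} [CommSemiring D] (a b : D) : Prop := a + b = b

variable {D : Type u} [CommSemiring D] [IsPIIRng D]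

theorem LE_iff_mul {a b : D} : LE a b ↔ a * b = a := by
  constructor
  · intro h
    have h' : a + b = b := h
    rw [← h', mul_add, mul_self]
    calc a + a * b = a * (1 + b) := by rw [mul_add, mul_one]
      _ = a := by rw [one_add, mul_one]
  · intro h
    change a + b = b
    calc a + b = a * b + b := by rw [h]
      _ = (1 + a) * b := by rw [add_mul, one_mul, add_comm]
      _ = b := by rw [one_add, one_mul]

theorem eq_one_of_isUnit {a : D} (h : IsUnit a) : a = 1 := by
  have := mul_self a
  exact h.mul_left_cancel (by rw [this, mul_one])

theorem isUnit_iff {a : D} : IsUnit a ↔ a = 1 :=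
  ⟨eq_one_of_isUnit, fun h => h ▸ isUnit_one⟩

theorem algebraMap_eq_one {T : Submonoid D} {s : D} (hs : s ∈ T) :
    algebraMap D (Localization T) s = 1 := by
  have h := IsLocalization.map_units (Localization T) (⟨s, hs⟩ : T)
  refine h.mul_left_cancel ?_
  change algebraMap D (Localization T) s * algebraMap D (Localization T) s =
    algebraMap D (Localization T) s * 1
  rw [← map_mul, mul_self, mul_one]

theorem algebraMap_surjective (T : Submonoid D) :
    Function.Surjective (algebraMap D (Localization T)) := fun x => by
  obtain ⟨a, s, rfl⟩ := IsLocalization.exists_mk'_eq T x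
  refine ⟨a, ?_⟩
  rw [← IsLocalization.mk'_spec (Localization T) a s, algebraMap_eq_one s.2, mul_one]

/-- The localization of a pre-complete idealic semiring with idempotent multiplication is of the
same kind. -/
instance localization (T : Submonoid D) : IsPIIRng (Localization T) where
  add_self x := by
    obtain ⟨a, rfl⟩ := algebraMap_surjective T x
    rw [← map_add, add_self]
  one_add x := by
    obtain ⟨a, rfl⟩ := algebraMap_surjective T x
    rw [← map_one (algebraMap D (Localization T)), ← map_add, one_add]
  mul_self x := by
    obtain ⟨a, rfl⟩ := algebraMap_surjective T x
    rw [← map_mul, mul_self]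

end IsPIIRng

/-- A bundled pre-complete idealic semiring with idempotent multiplication. -/
structure PIIRng : Type (u + 1) where
  /-- the underlying set -/
  carrier : Type u
  [commSemiring : CommSemiring carrier]
  [isPIIRng : IsPIIRng carrier]

attribute [instance] PIIRng.commSemiring PIIRng.isPIIRng

/-- The category of pre-complete idealic semirings with idempotent multiplication. -/
instance : Category.{u} PIIRng.{u} where
  Hom D D' := D.carrier →+* D'.carrier
  id D := RingHom.id D.carrier
  comp f g := RingHom.comp g f

namespace PIIRng

/-- The homomorphism of semirings underlying a morphism. -/
abbrev hom {D D' : PIIRng.{u}} (f : D ⟶ D') : D.carrier →+* D'.carrier := f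

@[simp] theorem hom_id (D : PIIRng.{u}) : hom (𝟙 D) = RingHom.id D.carrier := rfl

@[simp] theorem hom_comp {D D' D'' : PIIRng.{u}} (f : D ⟶ D') (g : D' ⟶ D'') :
    hom (f ≫ g) = (hom g).comp (hom f) := rfl

end PIIRng

/-! ### Compact closed sets of an algebraic sober space -/

/-- A compact element of the semiring of closed sets of `X`: a closed set whose complement is
quasi-compact. -/
@[ext]
structure CptClosed (X : Type u) [TopologicalSpace X] : Type u where
  /-- the underlying set -/
  carrier : Set X
  isClosed : IsClosed carrier
  isCompact_compl : IsCompact carrierᶜ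

namespace CptClosed

section semiring

variable {X : Type u} [TopologicalSpace X] [SpectralSpace X]

/-- The sum is the intersection. -/
instance : Add (CptClosed X) where
  add Z W := ⟨Z.carrier ∩ W.carrier, Z.isClosed.inter W.isClosed, by
    rw [Set.compl_inter]; exact Z.isCompact_compl.union W.isCompact_compl⟩

/-- The product is the union. -/
instance : Mul (CptClosed X) where
  mul Z W := ⟨Z.carrier ∪ W.carrier, Z.isClosed.union W.isClosed, by
    rw [Set.compl_union]
    exact QuasiSeparatedSpace.inter_isCompact _ _ Z.isClosed.isOpen_compl Z.isCompact_compl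
      W.isClosed.isOpen_compl W.isCompact_compl⟩

instance : Zero (CptClosed X) where
  zero := ⟨Set.univ, isClosed_univ, by rw [Set.compl_univ]; exact isCompact_empty⟩

instance : One (CptClosed X) where
  one := ⟨∅, isClosed_empty, by rw [Set.compl_empty]; exact isCompact_univ⟩

/-- The semiring `C(X)_cpt`. -/
instance : CommSemiring (CptClosed X) where
  add_assoc _ _ _ := CptClosed.ext (Set.inter_assoc _ _ _)
  zero_add _ := CptClosed.ext (Set.univ_inter _)
  add_zero _ := CptClosed.ext (Set.inter_univ _)
  add_comm _ _ := CptClosed.ext (Set.inter_comm _ _)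
  left_distrib _ _ _ := CptClosed.ext (Set.union_inter_distrib_left _ _ _)
  right_distrib _ _ _ := CptClosed.ext (Set.inter_union_distrib_right _ _ _)
  zero_mul _ := CptClosed.ext (Set.univ_union _)
  mul_zero _ := CptClosed.ext (Set.union_univ _)
  mul_assoc _ _ _ := CptClosed.ext (Set.union_assoc _ _ _)
  one_mul _ := CptClosed.ext (Set.empty_union _)
  mul_one _ := CptClosed.ext (Set.union_empty _)
  mul_comm _ _ := CptClosed.ext (Set.union_comm _ _)
  nsmul := nsmulRec

instance : IsPIIRng (CptClosed X) where
  add_self _ := CptClosed.ext (Set.inter_self _)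
  one_add _ := CptClosed.ext (Set.empty_inter _)
  mul_self _ := CptClosed.ext (Set.union_self _)

end semiring

section order

variable {X : Type u} [TopologicalSpace X]

/-- The order of `C(X)_cpt` is reverse inclusion of closed sets. -/
instance : PartialOrder (CptClosed X) where
  le Z W := W.carrier ⊆ Z.carrier
  le_refl Z := Set.Subset.refl Z.carrier
  le_trans _ _ _ h h' := Set.Subset.trans h' h
  le_antisymm _ _ h h' := CptClosed.ext (Set.Subset.antisymm h' h)

theorem le_def {Z W : CptClosed X} : Z ≤ W ↔ W.carrier ⊆ Z.carrier := Iff.rfl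

theorem le_iff [SpectralSpace X] {Z W : CptClosed X} : Z ≤ W ↔ IsPIIRng.LE Z W := by
  rw [le_def, ← Set.inter_eq_right]
  exact ⟨fun h => CptClosed.ext h, fun h => congrArg CptClosed.carrier h⟩

theorem le_add_left [SpectralSpace X] (Z W : CptClosed X) : Z ≤ Z + W := Set.inter_subset_left

theorem le_add_right [SpectralSpace X] (Z W : CptClosed X) : W ≤ Z + W := Set.inter_subset_right

theorem mul_le_left [SpectralSpace X] (Z W : CptClosed X) : Z * W ≤ Z := Set.subset_union_left

theorem mul_le_right [SpectralSpace X] (Z W : CptClosed X) : Z * W ≤ W := Set.subset_union_right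

end order

section comap

variable {X Y : Type u} [TopologicalSpace X] [TopologicalSpace Y]

/-- The inverse image of a compact closed set under a quasi-compact continuous map. -/
def comap {f : X → Y} (hf : IsSpectralMap f) (Z : CptClosed Y) : CptClosed X where
  carrier := f ⁻¹' Z.carrier
  isClosed := Z.isClosed.preimage hf.continuous
  isCompact_compl := Z.isCompact_compl.preimage_of_isOpen hf Z.isClosed.isOpen_compl

@[simp] theorem carrier_comap {f : X → Y} (hf : IsSpectralMap f) (Z : CptClosed Y) :
    (comap hf Z).carrier = f ⁻¹' Z.carrier := rfl

theorem comap_mono {f : X → Y} (hf : IsSpectralMap f) {Z W : CptClosed Y} (h : Z ≤ W) :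
    comap hf Z ≤ comap hf W := Set.preimage_mono h

/-- The map `C(f)_cpt` as a functor between the ordered sets. -/
def comapFunctor {f : X → Y} (hf : IsSpectralMap f) : CptClosed Y ⥤ CptClosed X where
  obj Z := comap hf Z
  map h := homOfLE (comap_mono hf (leOfHom h))

/-- The map `C(f)_cpt` as a homomorphism of semirings. -/
def comapHom [SpectralSpace X] [SpectralSpace Y] {f : X → Y} (hf : IsSpectralMap f) :
    CptClosed Y →+* CptClosed X where
  toFun := comap hf
  map_one' := rfl
  map_mul' _ _ := rfl
  map_zero' := rfl
  map_add' _ _ := rfl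

end comap

end CptClosed

/-! ### Sheaves on the compact closed sets -/

/-- A presheaf on `C(X)_cpt` is a sheaf if it sends `0` to a terminal object, and if it sends the
square formed by `Z₁ * Z₂`, `Z₁`, `Z₂` and `Z₁ + Z₂` to a fiber product: the sections over
`Z₁ + Z₂` are the pairs of sections over `Z₁` and `Z₂` which agree over `Z₁ * Z₂`. -/
def IsSheafCpt {X : Type u} [TopologicalSpace X] [SpectralSpace X] {C : Type w} [Category.{v} C]
    (F : (CptClosed X)ᵒᵖ ⥤ C) : Prop :=
  Nonempty (Limits.IsTerminal (F.obj (op 0))) ∧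
    ∀ Z₁ Z₂ : CptClosed X, IsPullback
      (F.map (homOfLE (CptClosed.le_add_left Z₁ Z₂)).op)
      (F.map (homOfLE (CptClosed.le_add_right Z₁ Z₂)).op)
      (F.map (homOfLE (CptClosed.mul_le_left Z₁ Z₂)).op)
      (F.map (homOfLE (CptClosed.mul_le_right Z₁ Z₂)).op)

section tau

variable {X Y : Type u} [TopologicalSpace X] [SpectralSpace X] [TopologicalSpace Y]
  [SpectralSpace Y]

theorem isUnit_away_of_le {Z W : CptClosed X} (h : W ≤ Z) (s : Submonoid.powers Z) :
    IsUnit (algebraMap (CptClosed X) (Localization (Submonoid.powers W)) s) := by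
  obtain ⟨s, n, rfl⟩ := s
  change IsUnit (algebraMap (CptClosed X) _ (Z ^ n))
  rw [map_pow]
  refine IsUnit.pow n (isUnit_of_mul_isUnit_right (x := algebraMap (CptClosed X) _ W) ?_)
  rw [← map_mul, IsPIIRng.LE_iff_mul.1 (CptClosed.le_iff.1 h)]
  exact IsLocalization.map_units _ (⟨W, Submonoid.mem_powers W⟩ : Submonoid.powers W)

/-- For `W ≤ Z`, the map `C(X)_{cpt,Z} → C(X)_{cpt,W}` between localizations of `C(X)_cpt`. -/
def tauRes {Z W : CptClosed X} (h : W ≤ Z) :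
    Localization (Submonoid.powers Z) →+* Localization (Submonoid.powers W) :=
  IsLocalization.lift (M := Submonoid.powers Z)
    (g := algebraMap (CptClosed X) (Localization (Submonoid.powers W))) (isUnit_away_of_le h)

theorem tauRes_algebraMap {Z W : CptClosed X} (h : W ≤ Z) (K : CptClosed X) :
    tauRes h (algebraMap _ (Localization (Submonoid.powers Z)) K) =
      algebraMap _ (Localization (Submonoid.powers W)) K :=
  IsLocalization.lift_eq _ K

theorem powers_hom_ext {Z : CptClosed X} {B : Type u} [CommSemiring B]
    {f g : Localization (Submonoid.powers Z) →+* B}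
    (h : ∀ K : CptClosed X, f (algebraMap _ _ K) = g (algebraMap _ _ K)) : f = g :=
  RingHom.ext fun x => by
    obtain ⟨K, rfl⟩ := IsPIIRng.algebraMap_surjective _ x
    exact h K

variable (X) in
/-- The structure presheaf `Z ↦ C(X)_{cpt,Z}` of the space `X`, with values in `PIIRng`. Here
`C(X)_{cpt,Z}` is the localization of `C(X)_cpt` along `Z`. -/
def tau : (CptClosed X)ᵒᵖ ⥤ PIIRng.{u} where
  obj Z := ⟨Localization (Submonoid.powers Z.unop)⟩
  map h := tauRes (leOfHom h.unop)
  map_id Z := powers_hom_ext fun K => tauRes_algebraMap _ K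
  map_comp {Z W V} h h' := powers_hom_ext fun K => by
    change tauRes _ _ = tauRes (leOfHom h'.unop) (tauRes (leOfHom h.unop) _)
    simp only [tauRes_algebraMap]

/-- The canonical map from `C(X)_cpt` to the sections of `τ'_X` over `Z`. -/
def toTau (Z : (CptClosed X)ᵒᵖ) : CptClosed X →+* ((tau X).obj Z).carrier :=
  algebraMap (CptClosed X) (Localization (Submonoid.powers Z.unop))

theorem tau_map_toTau {Z W : (CptClosed X)ᵒᵖ} (h : Z ⟶ W) (K : CptClosed X) :
    PIIRng.hom ((tau X).map h) (toTau Z K) = toTau W K :=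
  tauRes_algebraMap (leOfHom h.unop) K

theorem toTau_self (Z : (CptClosed X)ᵒᵖ) : toTau Z Z.unop = 1 :=
  IsPIIRng.algebraMap_eq_one (Submonoid.mem_powers Z.unop)

/-- The morphism `C(f)_cpt : τ'_Y ⟶ f_* τ'_X` on sections over `Z`. -/
def tauMapApp {f : X → Y} (hf : IsSpectralMap f) (Z : CptClosed Y) :
    Localization (Submonoid.powers Z) →+* Localization (Submonoid.powers (CptClosed.comap hf Z)) :=
  IsLocalization.map (M := Submonoid.powers Z) (T := Submonoid.powers (CptClosed.comap hf Z))
    (Localization (Submonoid.powers (CptClosed.comap hf Z))) (CptClosed.comapHom hf) (by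
      rw [Submonoid.powers_le]
      exact ⟨1, pow_one _⟩)

theorem tauMapApp_algebraMap {f : X → Y} (hf : IsSpectralMap f) (Z : CptClosed Y)
    (K : CptClosed Y) :
    tauMapApp hf Z (algebraMap _ (Localization (Submonoid.powers Z)) K) =
      algebraMap _ (Localization (Submonoid.powers (CptClosed.comap hf Z)))
        (CptClosed.comap hf K) :=
  IsLocalization.map_eq _ K

/-- The morphism `C(f)_cpt : τ'_Y ⟶ f_* τ'_X` for a quasi-compact continuous map `f : X → Y`. -/
def tauMap {f : X → Y} (hf : IsSpectralMap f) :
    tau Y ⟶ (CptClosed.comapFunctor hf).op ⋙ tau X where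
  app Z := tauMapApp hf Z.unop
  naturality Z W h := powers_hom_ext fun K => by
    change tauMapApp hf _ (tauRes (leOfHom h.unop) _) =
      tauRes (Z := CptClosed.comap hf Z.unop) (W := CptClosed.comap hf W.unop)
        (CptClosed.comap_mono hf (leOfHom h.unop)) (tauMapApp hf _ _)
    rw [tauRes_algebraMap, tauMapApp_algebraMap, tauMapApp_algebraMap, tauRes_algebraMap]

theorem tauMap_toTau {f : X → Y} (hf : IsSpectralMap f) (Z : (CptClosed Y)ᵒᵖ) (K : CptClosed Y) :
    PIIRng.hom ((tauMap hf).app Z) (toTau Z K) =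
      toTau ((CptClosed.comapFunctor hf).op.obj Z) (CptClosed.comap hf K) :=
  tauMapApp_algebraMap hf _ K

end tau

/-! ### Schematizable algebraic types -/

/-- The homomorphism `D_T → D'_{T'}` induced by a homomorphism `g : D → D'` with `g(T) ⊆ T'`. -/
def locMap {D D' : Type u} [CommSemiring D] [CommSemiring D'] {T : Submonoid D}
    {T' : Submonoid D'} (g : D →+* D') (h : ∀ d ∈ T, g d ∈ T') :
    Localization T →+* Localization T' :=
  IsLocalization.map (M := T) (T := T') (Localization T') g h

theorem locMap_algebraMap {D D' : Type u} [CommSemiring D] [CommSemiring D'] {T : Submonoid D}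
    {T' : Submonoid D'} (g : D →+* D') (h : ∀ d ∈ T, g d ∈ T') (d : D) :
    locMap g h (algebraMap D (Localization T) d) = algebraMap D' (Localization T') (g d) :=
  IsLocalization.map_eq _ d

/-- A schematizable algebraic type `(σ, α₁, α₂, γ)`: an algebraic type `σ` with a multiplicative
monoid structure, a functor `α₁` from `σ`-algebras to `PIIRng`, a natural transformation `α₂` from
the multiplicative monoid of `R` to that of `α₁(R)`, and an isomorphism `γ` between
`α₁(R)_{α₂(S)}` and `α₁(R_S)`, natural in the `σ`-algebra with multiplicative system `(R, S)`. -/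
structure SchematizableType : Type (u + 1) where
  /-- the algebraic type -/
  σ : MonAlgType.{u}
  /-- the functor to `PIIRng` -/
  α₁ : Alg σ.toAlgType ⥤ PIIRng.{u}
  /-- the comparison of multiplicative monoids -/
  α₂ : ∀ R : Alg σ.toAlgType, R.carrier →* (α₁.obj R).carrier
  α₂_natural : ∀ {A B : Alg σ.toAlgType} (f : A ⟶ B) (x : A.carrier),
    PIIRng.hom (α₁.map f) (α₂ A x) = α₂ B (f x)
  /-- the commutation with localization -/
  γ : ∀ (R : Alg σ.toAlgType) (S : Submonoid R.carrier),
    Localization (S.map (α₂ R)) ≃+* (α₁.obj (Loc R S)).carrier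
  γ_natural : ∀ {A B : Alg σ.toAlgType} {S : Submonoid A.carrier} {T : Submonoid B.carrier}
    (f : A ⟶ B) (h : ∀ s ∈ S, f s ∈ T)
    (h' : ∀ d ∈ S.map (α₂ A), PIIRng.hom (α₁.map f) d ∈ T.map (α₂ B))
    (x : Localization (S.map (α₂ A))),
    PIIRng.hom (α₁.map (Loc.map f h)) (γ A S x) =
      γ B T (locMap (PIIRng.hom (α₁.map f)) h' x)

/-- The canonical homomorphism `R_x ⟶ R_{xy}`. -/
def Loc.awayLeft {R : Alg σ.toAlgType} (x y : R.carrier) :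
    Loc R (Submonoid.powers x) ⟶ Loc R (Submonoid.powers (x * y)) :=
  Loc.lift (Loc.ι R (Submonoid.powers (x * y))) (by
    rintro _ ⟨n, rfl⟩
    have h := Loc.isUnit_ι (Submonoid.mem_powers (x * y))
    change IsUnit (Alg.toMonoidHom (Loc.ι R (Submonoid.powers (x * y))) (x ^ n))
    rw [map_pow]
    change IsUnit (Alg.toMonoidHom (Loc.ι R (Submonoid.powers (x * y))) (x * y)) at h
    rw [map_mul] at h
    exact (isUnit_of_mul_isUnit_left h).pow n)

/-- The canonical homomorphism `R_y ⟶ R_{xy}`. -/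
def Loc.awayRight {R : Alg σ.toAlgType} (x y : R.carrier) :
    Loc R (Submonoid.powers y) ⟶ Loc R (Submonoid.powers (x * y)) :=
  Loc.lift (Loc.ι R (Submonoid.powers (x * y))) (by
    rintro _ ⟨n, rfl⟩
    have h := Loc.isUnit_ι (Submonoid.mem_powers (x * y))
    change IsUnit (Alg.toMonoidHom (Loc.ι R (Submonoid.powers (x * y))) (y ^ n))
    rw [map_pow]
    change IsUnit (Alg.toMonoidHom (Loc.ι R (Submonoid.powers (x * y))) (x * y)) at h
    rw [map_mul] at h
    exact (isUnit_of_mul_isUnit_right h).pow n)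

/-- The weak patching condition. -/
structure SchematizableType.WeakPatching (𝒜 : SchematizableType.{u}) : Prop where
  /-- `α₁(R)` is generated by `α₂(R)`. -/
  generates : ∀ R : Alg 𝒜.σ.toAlgType, Subsemiring.closure (Set.range (𝒜.α₂ R)) = ⊤
  /-- If `α₂(s₁) + ⋯ + α₂(sₙ) = 1`, then a family of elements of the `R_{sᵢ}` which agree in the
  `R_{sᵢsⱼ}` comes from a unique element of `R`. -/
  patch : ∀ (R : Alg 𝒜.σ.toAlgType) (n : ℕ) (s : Fin (n + 1) → R.carrier),
    ∑ i, 𝒜.α₂ R (s i) = 1 →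
    ∀ a : ∀ i, (Loc R (Submonoid.powers (s i))).carrier,
      (∀ i j, Loc.awayLeft (s i) (s j) (a i) = Loc.awayRight (s i) (s j) (a j)) →
      ∃! b : R.carrier, ∀ i, Loc.ι R (Submonoid.powers (s i)) b = a i

/-! ### `𝒜`-schemes -/

/-- An `𝒜`-scheme `(X, O_X, β_X)`.

The sheaf `τ'_X` being a sheaf, a morphism of sheaves from the sheafification of `α₁ ∘ O_X` to
`τ'_X` is the same thing as a morphism of presheaves from `α₁ ∘ O_X` to `τ'_X`; `β` is given in the
latter form. -/
structure Scheme (𝒜 : SchematizableType.{u}) : Type (u + 1) where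
  /-- the underlying space -/
  carrier : Type u
  [top : TopologicalSpace carrier]
  [spectral : SpectralSpace carrier]
  /-- the structure sheaf -/
  O : (CptClosed carrier)ᵒᵖ ⥤ Alg 𝒜.σ.toAlgType
  isSheaf : IsSheafCpt O
  /-- the comparison map -/
  β : O ⋙ 𝒜.α₁ ⟶ tau carrier
  /-- The restriction maps reflect localization: if `β(α₂(a)) ≥ W`, then the restriction
  `O(Z) ⟶ O(W)` factors through `O(Z)_a`. -/
  reflects : ∀ (Z W : CptClosed carrier) (h : W ≤ Z) (a : (O.obj (op Z)).carrier),
    IsPIIRng.LE (toTau (op Z) W) (PIIRng.hom (β.app (op Z)) (𝒜.α₂ (O.obj (op Z)) a)) →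
    ∃ g : Loc (O.obj (op Z)) (Submonoid.powers a) ⟶ O.obj (op W),
      Loc.ι (O.obj (op Z)) (Submonoid.powers a) ≫ g = O.map (homOfLE h).op

attribute [instance] Scheme.top Scheme.spectral

namespace Scheme

variable {𝒜 : SchematizableType.{u}}

/-- A morphism of `𝒜`-schemes: a quasi-compact continuous map `f`, and a morphism of sheaves
`f^♯ : O_Y ⟶ f_* O_X` which is compatible with `β_Y`, `β_X` and `C(f)_cpt : τ'_Y ⟶ f_* τ'_X`. -/
structure Hom (X Y : Scheme 𝒜) : Type u where
  /-- the continuous map -/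
  base : X.carrier → Y.carrier
  isSpectralMap : IsSpectralMap base
  /-- the morphism of sheaves -/
  sharp : Y.O ⟶ (CptClosed.comapFunctor isSpectralMap).op ⋙ X.O
  comm : ∀ Z : (CptClosed Y.carrier)ᵒᵖ,
    Y.β.app Z ≫ (tauMap isSpectralMap).app Z =
      𝒜.α₁.map (sharp.app Z) ≫ X.β.app ((CptClosed.comapFunctor isSpectralMap).op.obj Z)

theorem Hom.ext' {X Y : Scheme 𝒜} {f g : Hom X Y} (h : f.base = g.base)
    (h' : ∀ (Z : CptClosed Y.carrier)
      (e : CptClosed.comap g.isSpectralMap Z ≤ CptClosed.comap f.isSpectralMap Z),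
      f.sharp.app (op Z) ≫ X.O.map (homOfLE e).op = g.sharp.app (op Z)) : f = g := by
  obtain ⟨f, hf, f', hfc⟩ := f
  obtain ⟨g, hg, g', hgc⟩ := g
  change f = g at h
  subst h
  have : f' = g' := by
    ext Z : 2
    have := h' Z.unop le_rfl
    change f'.app Z ≫ X.O.map (𝟙 _) = g'.app Z at this
    rw [X.O.map_id] at this
    exact (Category.comp_id _).symm.trans this
  subst this
  rfl

theorem tauMap_id_app (X : Scheme 𝒜) (Z : (CptClosed X.carrier)ᵒᵖ) :
    (tauMap (isSpectralMap_id (α := X.carrier))).app Z = 𝟙 ((tau X.carrier).obj Z) :=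
  powers_hom_ext fun K => tauMapApp_algebraMap isSpectralMap_id Z.unop K

theorem tauMap_comp_app {X Y Z : Scheme 𝒜} {f : X.carrier → Y.carrier} {g : Y.carrier → Z.carrier}
    (hf : IsSpectralMap f) (hg : IsSpectralMap g) (W : (CptClosed Z.carrier)ᵒᵖ) :
    (tauMap (hg.comp hf)).app W =
      (tauMap hg).app W ≫ (tauMap hf).app ((CptClosed.comapFunctor hg).op.obj W) :=
  powers_hom_ext fun K => by
    refine (tauMapApp_algebraMap (hg.comp hf) W.unop K).trans ?_
    refine Eq.trans ?_ (congrArg (tauMapApp hf (CptClosed.comap hg W.unop))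
      (tauMapApp_algebraMap hg W.unop K).symm)
    exact (tauMapApp_algebraMap hf (CptClosed.comap hg W.unop) (CptClosed.comap hg K)).symm

/-- The identity morphism. -/
def Hom.id (X : Scheme 𝒜) : Hom X X where
  base := fun x => x
  isSpectralMap := isSpectralMap_id
  sharp :=
    { app := fun Z => 𝟙 (X.O.obj Z)
      naturality := fun _ _ _ => (Category.comp_id _).trans (Category.id_comp _).symm }
  comm Z := by
    refine (congrArg (fun t => X.β.app Z ≫ t) (tauMap_id_app X Z)).trans ?_
    refine (Category.comp_id _).trans ?_
    refine Eq.trans (Category.id_comp _).symm ?_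
    exact congrArg (fun t => t ≫ X.β.app Z) (𝒜.α₁.map_id (X.O.obj Z)).symm

/-- The composition of morphisms. -/
def Hom.comp {X Y Z : Scheme 𝒜} (f : Hom X Y) (g : Hom Y Z) : Hom X Z where
  base := g.base ∘ f.base
  isSpectralMap := g.isSpectralMap.comp f.isSpectralMap
  sharp :=
    { app := fun W => g.sharp.app W ≫
        f.sharp.app ((CptClosed.comapFunctor g.isSpectralMap).op.obj W)
      naturality := fun W W' h => by
        have h1 := g.sharp.naturality h
        have h2 := f.sharp.naturality ((CptClosed.comapFunctor g.isSpectralMap).op.map h)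
        refine (Category.assoc _ _ _).symm.trans ?_
        refine (congrArg (fun t => t ≫ _) h1).trans ?_
        refine (Category.assoc _ _ _).trans ?_
        refine (congrArg (fun t => _ ≫ t) h2).trans ?_
        exact (Category.assoc _ _ _).symm }
  comm W := by
    have h1 := g.comm W
    have h2 := f.comm ((CptClosed.comapFunctor g.isSpectralMap).op.obj W)
    refine (congrArg (fun t => Z.β.app W ≫ t)
      (tauMap_comp_app f.isSpectralMap g.isSpectralMap W)).trans ?_
    refine (Category.assoc _ _ _).symm.trans ?_
    refine (congrArg (fun t => t ≫ _) h1).trans ?_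
    refine (Category.assoc _ _ _).trans ?_
    refine (congrArg (fun t => _ ≫ t) h2).trans ?_
    refine (Category.assoc _ _ _).symm.trans ?_
    exact congrArg (fun t => t ≫ _) (𝒜.α₁.map_comp _ _).symm

/-- The category of `𝒜`-schemes. -/
instance : Category.{u} (Scheme 𝒜) where
  Hom := Hom
  id := Hom.id
  comp := Hom.comp
  id_comp {X Y} f := Hom.ext' rfl fun Z e => by
    have e1 : X.O.map (homOfLE e).op = 𝟙 _ := X.O.map_id _
    refine (congrArg (fun t => _ ≫ t) e1).trans ((Category.comp_id _).trans ?_)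
    exact Category.comp_id _
  comp_id {X Y} f := Hom.ext' rfl fun Z e => by
    have e1 : X.O.map (homOfLE e).op = 𝟙 _ := X.O.map_id _
    refine (congrArg (fun t => _ ≫ t) e1).trans ((Category.comp_id _).trans ?_)
    exact Category.id_comp _
  assoc {X Y Z W} f g h := Hom.ext' rfl fun Z e => by
    have e1 : X.O.map (homOfLE e).op = 𝟙 _ := X.O.map_id _
    refine (congrArg (fun t => _ ≫ t) e1).trans ((Category.comp_id _).trans ?_)
    exact (Category.assoc _ _ _).symm

variable (𝒜) in
/-- The global section functor `X ↦ O_X(1)`; here `1 ∈ C(X)_cpt` is the empty closed set. -/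
def Γ : (Scheme 𝒜)ᵒᵖ ⥤ Alg 𝒜.σ.toAlgType where
  obj X := X.unop.O.obj (op 1)
  map f := f.unop.sharp.app (op 1)
  map_id _ := rfl
  map_comp _ _ := rfl

end Scheme

/-! ### The structure sheaf of the spectrum -/

theorem CptClosed.exists_le_of_finite {X : Type u} [TopologicalSpace X] [SpectralSpace X]
    (Z : CptClosed X) {n : ℕ} (W : Fin n → CptClosed X) (p : X) (hp : p ∉ Z.carrier)
    (hW : ∀ i, p ∉ (W i).carrier) :
    ∃ V : CptClosed X, V ≤ Z ∧ p ∉ V.carrier ∧ ∀ i, V ≤ W i := by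
  refine ⟨Z * ∏ i, W i, mul_le_left _ _, ?_, fun i => (mul_le_right _ _).trans ?_⟩
  · have : p ∉ (∏ i, W i).carrier := by
      refine Finset.prod_induction W (fun V => p ∉ V.carrier) (fun a b ha hb h => ?_) id
        fun i _ => hW i
      exact h.elim ha hb
    exact fun h => h.elim hp this
  · obtain ⟨c, hc⟩ := Finset.dvd_prod_of_mem W (Finset.mem_univ i)
    rw [hc]
    exact mul_le_left _ _

/-- In the category of `σ`-algebras, a square with the usual unique existence property on elements
is a fiber product. -/
theorem Alg.isPullback_of {σ : AlgType.{u}} {P A B C : Alg σ} {f : P ⟶ A} {g : P ⟶ B} {h : A ⟶ C}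
    {k : B ⟶ C} (comm : f ≫ h = g ≫ k)
    (H : ∀ a b, h a = k b → ∃! p, f p = a ∧ g p = b) : IsPullback f g h k := by
  have hs : ∀ (s : Limits.PullbackCone h k) x, h (s.fst x) = k (s.snd x) := fun s x =>
    congrArg (fun t => AlgHom.toFun t x) s.condition
  refine ⟨⟨comm⟩, ⟨Limits.PullbackCone.IsLimit.mk comm (fun s => ?_) (fun s => ?_) (fun s => ?_)
    (fun s m h1 h2 => ?_)⟩⟩
  · exact
      { toFun := fun x => (H _ _ (hs s x)).choose
        map_op := fun ω x => by
          symm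
          refine (H _ _ (hs s _)).choose_spec.2 _ ⟨?_, ?_⟩
          · rw [Alg.map_op, Alg.map_op]
            exact congrArg _ (funext fun i => (H _ _ (hs s (x i))).choose_spec.1.1)
          · rw [Alg.map_op, Alg.map_op]
            exact congrArg _ (funext fun i => (H _ _ (hs s (x i))).choose_spec.1.2) }
  · exact Alg.hom_ext fun x => (H _ _ (hs s x)).choose_spec.1.1
  · exact Alg.hom_ext fun x => (H _ _ (hs s x)).choose_spec.1.2
  · refine Alg.hom_ext fun x => (H _ _ (hs s x)).choose_spec.2 _ ⟨?_, ?_⟩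
    · exact congrArg (fun t => AlgHom.toFun t x) h1
    · exact congrArg (fun t => AlgHom.toFun t x) h2

namespace Spec

variable {𝒜 : SchematizableType.{u}}

/-- The underlying space `Spec α₁(R)^†` of the spectrum of `R`: a prime element of the completion
`α₁(R)^†`, whose elements are the ideals of `α₁(R)`, is a prime ideal of `α₁(R)`. -/
abbrev Space (R : Alg 𝒜.σ.toAlgType) : Type u := PrimeSpectrum (𝒜.α₁.obj R).carrier

/-- The compact closed set `V(d)`, for `d ∈ α₁(R)`. -/
def V {R : Alg 𝒜.σ.toAlgType} (d : (𝒜.α₁.obj R).carrier) : CptClosed (Space R) where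
  carrier := PrimeSpectrum.zeroLocus {d}
  isClosed := PrimeSpectrum.isClosed_zeroLocus _
  isCompact_compl := by
    rw [← PrimeSpectrum.basicOpen_eq_zeroLocus_compl]
    exact PrimeSpectrum.isCompact_basicOpen d

theorem mem_V {R : Alg 𝒜.σ.toAlgType} (d : (𝒜.α₁.obj R).carrier) (p : Space R) :
    p ∈ (V d).carrier ↔ d ∈ p.asIdeal := by
  change p ∈ PrimeSpectrum.zeroLocus {d} ↔ _
  rw [PrimeSpectrum.mem_zeroLocus, Set.singleton_subset_iff]
  rfl

/-- The multiplicative system `{x ∈ R ∣ α₂(x) ≥ Z}`, for a compact closed set `Z` of the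
spectrum. -/
def secMon {R : Alg 𝒜.σ.toAlgType} (Z : CptClosed (Space R)) : Submonoid R.carrier where
  carrier := {x | Z ≤ V (𝒜.α₂ R x)}
  one_mem' := by
    intro p hp
    rw [mem_V, map_one] at hp
    exact absurd hp (p.asIdeal.ne_top_iff_one.1 p.isPrime.ne_top)
  mul_mem' := by
    intro x y hx hy p hp
    rw [mem_V, map_mul] at hp
    rcases p.isPrime.mem_or_mem hp with h | h
    · exact hx ((mem_V _ _).2 h)
    · exact hy ((mem_V _ _).2 h)

theorem secMon_mono {R : Alg 𝒜.σ.toAlgType} {Z W : CptClosed (Space R)} (h : W ≤ Z) :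
    secMon Z ≤ secMon W := fun _ hx => le_trans h hx

/-- The multiplicative system `{x ∈ R ∣ α₂(x) ≰ p}`, for a point `p` of the spectrum. -/
def stalkMon {R : Alg 𝒜.σ.toAlgType} (p : Space R) : Submonoid R.carrier :=
  p.asIdeal.primeCompl.comap (𝒜.α₂ R)

theorem secMon_le_stalkMon {R : Alg 𝒜.σ.toAlgType} {Z : CptClosed (Space R)} {p : Space R}
    (hp : p ∉ Z.carrier) : secMon Z ≤ stalkMon p :=
  fun _ hx h => hp (hx ((mem_V _ _).2 h))

/-- The presheaf `O'_X : Z ↦ R_Z` on `X = Spec R`. -/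
def preO (R : Alg 𝒜.σ.toAlgType) : (CptClosed (Space R))ᵒᵖ ⥤ Alg 𝒜.σ.toAlgType where
  obj Z := Loc R (secMon Z.unop)
  map h := Loc.res (secMon_mono (leOfHom h.unop))
  map_id _ := Loc.hom_ext fun _ => rfl
  map_comp _ _ := Loc.hom_ext fun _ => rfl

/-- The map `R_Z ⟶ R_p` to the stalk, for a point `p ∉ Z`. -/
def germ {R : Alg 𝒜.σ.toAlgType} {Z : CptClosed (Space R)} {p : Space R} (hp : p ∉ Z.carrier) :
    Loc R (secMon Z) ⟶ Loc R (stalkMon p) := Loc.res (secMon_le_stalkMon hp)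

theorem germ_res {R : Alg 𝒜.σ.toAlgType} {Z W : CptClosed (Space R)} (h : W ≤ Z) {p : Space R}
    (hp : p ∉ W.carrier) (b : (Loc R (secMon Z)).carrier) :
    germ hp (Loc.res (secMon_mono h) b) = germ (fun h' => hp (h h')) b := by
  have : Loc.res (secMon_mono h) ≫ germ hp = germ (fun h' => hp (h h')) :=
    Loc.hom_ext fun _ => rfl
  exact congrArg (fun t => AlgHom.toFun t b) this

/-- A family of elements of the stalks `R_p`, for `p ∉ Z`, is a section over `Z` of the
sheafification of `O'` if it comes locally from elements of the `R_W`. -/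
def IsLocallyFraction {R : Alg 𝒜.σ.toAlgType} (Z : CptClosed (Space R))
    (s : ∀ p : {p : Space R // p ∉ Z.carrier}, (Loc R (stalkMon p.1)).carrier) : Prop :=
  ∀ p : {p : Space R // p ∉ Z.carrier}, ∃ (W : CptClosed (Space R)) (hW : W ≤ Z),
    p.1 ∉ W.carrier ∧ ∃ b : (Loc R (secMon W)).carrier,
      ∀ (q : Space R) (hq : q ∉ W.carrier), s ⟨q, fun h => hq (hW h)⟩ = germ hq b

theorem isLocallyFraction_op {R : Alg 𝒜.σ.toAlgType} {Z : CptClosed (Space R)} (ω : 𝒜.σ.Op)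
    (s : Fin (𝒜.σ.arity ω) → {s : ∀ p : {p : Space R // p ∉ Z.carrier},
      (Loc R (stalkMon p.1)).carrier // IsLocallyFraction Z s}) :
    IsLocallyFraction Z fun p => (Loc R (stalkMon p.1)).op ω fun i => (s i).1 p := fun p => by
  choose W hW hp b hb using fun i => (s i).2 p
  obtain ⟨U, hUZ, hpU, hU⟩ := CptClosed.exists_le_of_finite Z W p.1 p.2 hp
  refine ⟨U, hUZ, hpU, (Loc R (secMon U)).op ω fun i => Loc.res (secMon_mono (hU i)) (b i),
    fun q hq => ?_⟩
  rw [Alg.map_op]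
  refine congrArg _ (funext fun i => ?_)
  rw [germ_res (hU i)]
  exact hb i q _

/-- The `σ`-algebra of sections over `Z` of the sheafification of `O'`. -/
def sections {R : Alg 𝒜.σ.toAlgType} (Z : CptClosed (Space R)) : Alg 𝒜.σ.toAlgType where
  carrier := {s : ∀ p : {p : Space R // p ∉ Z.carrier}, (Loc R (stalkMon p.1)).carrier //
    IsLocallyFraction Z s}
  op ω s := ⟨fun p => (Loc R (stalkMon p.1)).op ω fun i => (s i).1 p, isLocallyFraction_op ω s⟩
  ident e he x := by
    refine Subtype.ext (funext fun p => ?_)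
    have key := fun t => Term.map_eval (A := {s : ∀ p : {p : Space R // p ∉ Z.carrier},
        (Loc R (stalkMon p.1)).carrier // IsLocallyFraction Z s})
      (op := fun ω s => ⟨fun p => (Loc R (stalkMon p.1)).op ω fun i => (s i).1 p,
        isLocallyFraction_op ω s⟩)
      (op' := (Loc R (stalkMon p.1)).op) (f := fun s => s.1 p) (fun _ _ => rfl) x t
    exact (key e.1).trans (((Loc R (stalkMon p.1)).ident e he _).trans (key e.2).symm)

/-- The value of a section in the stalk at `p`. -/
def ev {R : Alg 𝒜.σ.toAlgType} {Z : CptClosed (Space R)} {p : Space R} (hp : p ∉ Z.carrier) :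
    sections Z ⟶ Loc R (stalkMon p) where
  toFun s := s.1 ⟨p, hp⟩
  map_op _ _ := rfl

theorem sections_ext {R : Alg 𝒜.σ.toAlgType} {Z : CptClosed (Space R)}
    {s t : (sections Z).carrier} (h : ∀ p (hp : p ∉ Z.carrier), ev hp s = ev hp t) : s = t :=
  Subtype.ext (funext fun p => h p.1 p.2)

/-- The structure sheaf `O_X` of `X = Spec R`, the sheafification of `O' : Z ↦ R_Z`. -/
def structureSheaf (R : Alg 𝒜.σ.toAlgType) : (CptClosed (Space R))ᵒᵖ ⥤ Alg 𝒜.σ.toAlgType where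
  obj Z := sections Z.unop
  map {Z W} h :=
    { toFun := fun s => ⟨fun p => s.1 ⟨p.1, fun h' => p.2 (leOfHom h.unop h')⟩, fun p => by
        obtain ⟨U, hU, hpU, b, hb⟩ := s.2 ⟨p.1, fun h' => p.2 (leOfHom h.unop h')⟩
        refine ⟨W.unop * U, CptClosed.mul_le_left _ _, fun h' => h'.elim p.2 hpU,
          Loc.res (secMon_mono (CptClosed.mul_le_right _ _)) b, fun q hq => ?_⟩
        rw [germ_res (CptClosed.mul_le_right _ _)]
        exact hb q _⟩
      map_op := fun _ _ => rfl }
  map_id _ := rfl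
  map_comp _ _ := rfl

theorem ev_map {R : Alg 𝒜.σ.toAlgType} {Z W : (CptClosed (Space R))ᵒᵖ} (h : Z ⟶ W) {p : Space R}
    (hp : p ∉ W.unop.carrier) (s : (sections Z.unop).carrier) :
    ev hp ((structureSheaf R).map h s) = ev (fun h' => hp (leOfHom h.unop h')) s := rfl

/-- The canonical morphism `O' ⟶ O` from the presheaf `Z ↦ R_Z` to its sheafification. -/
def toStructureSheaf (R : Alg 𝒜.σ.toAlgType) : preO R ⟶ structureSheaf R where
  app Z :=
    { toFun := fun b => ⟨fun p => germ p.2 b, fun p => ⟨Z.unop, le_rfl, p.2, b, fun _ _ => rfl⟩⟩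
      map_op := fun ω b => Subtype.ext (funext fun p => Alg.map_op (germ p.2) ω b) }
  naturality _ _ h := Alg.hom_ext fun b => Subtype.ext (funext fun p =>
    germ_res (leOfHom h.unop) p.2 b)

theorem isSheaf_structureSheaf (R : Alg 𝒜.σ.toAlgType) : IsSheafCpt (structureSheaf R) := by
  constructor
  · have hp : ∀ p : {p : Space R // p ∉ (0 : CptClosed (Space R)).carrier}, False :=
      fun p => p.2 (Set.mem_univ p.1)
    refine ⟨Limits.IsTerminal.ofUniqueHom (fun A => ?_) (fun A m => ?_)⟩
    · exact
        { toFun := fun _ => ⟨fun p => (hp p).elim, fun p => (hp p).elim⟩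
          map_op := fun _ _ => Subtype.ext (funext fun p => (hp p).elim) }
    · exact Alg.hom_ext fun _ => Subtype.ext (funext fun p => (hp p).elim)
  · intro Z₁ Z₂
    refine Alg.isPullback_of rfl fun s t hst => ?_
    have hst' : ∀ p (h₁ : p ∉ Z₁.carrier) (h₂ : p ∉ Z₂.carrier), ev h₁ s = ev h₂ t :=
      fun p h₁ h₂ => congrArg (ev (Z := Z₁ * Z₂) (p := p) fun h => h.elim h₁ h₂) hst
    classical
    let r : ∀ p : {p : Space R // p ∉ (Z₁ + Z₂).carrier}, (Loc R (stalkMon p.1)).carrier :=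
      fun p => if h : p.1 ∈ Z₁.carrier then ev (fun h' => p.2 ⟨h, h'⟩) t else ev h s
    have r₁ : ∀ p (h₁ : p ∉ Z₁.carrier), r ⟨p, fun h => h₁ h.1⟩ = ev h₁ s :=
      fun p h₁ => dif_neg h₁
    have r₂ : ∀ p (h₂ : p ∉ Z₂.carrier), r ⟨p, fun h => h₂ h.2⟩ = ev h₂ t := fun p h₂ => by
      by_cases h₁ : p ∈ Z₁.carrier
      · exact dif_pos h₁
      · rw [r₁ p h₁, hst' p h₁ h₂]
    have hr : IsLocallyFraction (Z₁ + Z₂) r := fun p => by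
      by_cases h₁ : p.1 ∈ Z₁.carrier
      · have h₂ : p.1 ∉ Z₂.carrier := fun h => p.2 ⟨h₁, h⟩
        obtain ⟨W, hW, hpW, b, hb⟩ := t.2 ⟨p.1, h₂⟩
        exact ⟨W, hW.trans (CptClosed.le_add_right _ _), hpW, b,
          fun q hq => (r₂ q fun h => hq (hW h)).trans (hb q hq)⟩
      · obtain ⟨W, hW, hpW, b, hb⟩ := s.2 ⟨p.1, h₁⟩
        exact ⟨W, hW.trans (CptClosed.le_add_left _ _), hpW, b,
          fun q hq => (r₁ q fun h => hq (hW h)).trans (hb q hq)⟩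
    refine ⟨⟨r, hr⟩, ⟨?_, ?_⟩, ?_⟩
    · exact sections_ext fun p hp => r₁ p hp
    · exact sections_ext fun p hp => r₂ p hp
    · rintro y ⟨hy₁, hy₂⟩
      refine sections_ext fun p hp => ?_
      by_cases h₁ : p ∈ Z₁.carrier
      · have h₂ : p ∉ Z₂.carrier := fun h => hp ⟨h₁, h⟩
        exact (congrArg (ev h₂) hy₂).trans (r₂ p h₂).symm
      · exact (congrArg (ev h₁) hy₁).trans (r₁ p h₁).symm

end Spec

namespace Spec

/-! ### The comparison map of the spectrum -/

variable {𝒜 : SchematizableType.{u}}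

theorem algebraMap_primeCompl_eq_one {D : PIIRng.{u}} (p : PrimeSpectrum D.carrier)
    (d : D.carrier) :
    algebraMap D.carrier (Localization p.asIdeal.primeCompl) d = 1 ↔ d ∉ p.asIdeal := by
  rw [← IsPIIRng.isUnit_iff]
  exact IsLocalization.AtPrime.isUnit_to_map_iff (Localization p.asIdeal.primeCompl) p.asIdeal d

theorem add_mem_iff {D : PIIRng.{u}} (p : PrimeSpectrum D.carrier) (d e : D.carrier) :
    d + e ∈ p.asIdeal ↔ d ∈ p.asIdeal ∧ e ∈ p.asIdeal := by
  have key : ∀ d e : D.carrier, d + e ∈ p.asIdeal → d ∈ p.asIdeal := fun d e h => by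
    have h1 : IsPIIRng.LE d (d + e) := by
      change d + (d + e) = d + e
      rw [← add_assoc, IsPIIRng.add_self]
    rw [← IsPIIRng.LE_iff_mul.1 h1]
    exact p.asIdeal.mul_mem_left d h
  exact ⟨fun h => ⟨key d e h, key e d (by rwa [add_comm])⟩, fun h => p.asIdeal.add_mem h.1 h.2⟩

theorem add_eq_one_iff {D : PIIRng.{u}} (p : PrimeSpectrum D.carrier)
    (x y : Localization p.asIdeal.primeCompl) : x + y = 1 ↔ x = 1 ∨ y = 1 := by
  obtain ⟨d, rfl⟩ := IsPIIRng.algebraMap_surjective _ x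
  obtain ⟨e, rfl⟩ := IsPIIRng.algebraMap_surjective _ y
  rw [← map_add, algebraMap_primeCompl_eq_one, algebraMap_primeCompl_eq_one,
    algebraMap_primeCompl_eq_one, add_mem_iff, not_and_or]

theorem mul_eq_one_iff {D : Type u} [CommSemiring D] [IsPIIRng D] (x y : D) :
    x * y = 1 ↔ x = 1 ∧ y = 1 := by
  simp only [← IsPIIRng.isUnit_iff, IsUnit.mul_iff]

theorem zero_ne_one_stalk {D : PIIRng.{u}} (p : PrimeSpectrum D.carrier) :
    (0 : Localization p.asIdeal.primeCompl) ≠ 1 := by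
  rw [← map_zero (algebraMap D.carrier (Localization p.asIdeal.primeCompl)), Ne,
    algebraMap_primeCompl_eq_one, not_not]
  exact p.asIdeal.zero_mem

/-- The map `α₁(R)_{α₂(S)} → α₁(R)_p`, where `S = {x ∣ α₂(x) ≰ p}`. -/
def toStalk {R : Alg 𝒜.σ.toAlgType} (p : Space R) :
    Localization ((stalkMon p).map (𝒜.α₂ R)) →+* Localization p.asIdeal.primeCompl :=
  locMap (RingHom.id _) (by rintro _ ⟨x, hx, rfl⟩; exact hx)

/-- The map `α₁(R_p) ≃ α₁(R)_{α₂(S)} → α₁(R)_p`, where `S = {x ∣ α₂(x) ≰ p}`. -/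
def stalkBeta {R : Alg 𝒜.σ.toAlgType} (p : Space R) :
    (𝒜.α₁.obj (Loc R (stalkMon p))).carrier →+* Localization p.asIdeal.primeCompl :=
  (toStalk p).comp
    ((𝒜.γ R (stalkMon p)).symm : _ →+* _)

theorem stalkBeta_γ {R : Alg 𝒜.σ.toAlgType} (p : Space R) (d : (𝒜.α₁.obj R).carrier) :
    stalkBeta p (𝒜.γ R (stalkMon p) (algebraMap (𝒜.α₁.obj R).carrier _ d)) =
      algebraMap (𝒜.α₁.obj R).carrier _ d := by
  refine (congrArg (toStalk p) (RingEquiv.symm_apply_apply _ _)).trans ?_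
  exact locMap_algebraMap _ _ d

/-- On the image of `α₁(R_Z)`, the maps `stalkBeta` come from one element of `α₁(R)`. -/
theorem stalkBeta_germ {R : Alg 𝒜.σ.toAlgType} {Z : CptClosed (Space R)}
    (y : (𝒜.α₁.obj (Loc R (secMon Z))).carrier) (d : (𝒜.α₁.obj R).carrier)
    (hd : (𝒜.γ R (secMon Z)).symm y = algebraMap (𝒜.α₁.obj R).carrier _ d) {p : Space R} (hp : p ∉ Z.carrier) :
    stalkBeta p (PIIRng.hom (𝒜.α₁.map (germ hp)) y) =
      algebraMap (𝒜.α₁.obj R).carrier _ d := by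
  have hy : y = 𝒜.γ R (secMon Z) (algebraMap (𝒜.α₁.obj R).carrier _ d) := by
    rw [← hd, RingEquiv.apply_symm_apply]
  have h1 := 𝒜.γ_natural (𝟙 R) (secMon_le_stalkMon hp) (by
    rintro _ ⟨x, hx, rfl⟩
    rw [𝒜.α₂_natural]
    exact ⟨x, secMon_le_stalkMon hp hx, rfl⟩) (algebraMap (𝒜.α₁.obj R).carrier _ d)
  rw [hy]
  refine (congrArg (stalkBeta p) h1).trans ?_
  rw [locMap_algebraMap, 𝒜.α₁.map_id]
  exact stalkBeta_γ p d

/-- A family of elements of `α₁(R)_p`, for `p ∉ Z`, that comes locally from elements of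
`α₁(R)`. -/
def IsGood {R : Alg 𝒜.σ.toAlgType} (Z : CptClosed (Space R))
    (c : ∀ p : Space R, p ∉ Z.carrier → Localization p.asIdeal.primeCompl) : Prop :=
  ∀ p, p ∉ Z.carrier → ∃ (W : CptClosed (Space R)) (hW : W ≤ Z), p ∉ W.carrier ∧
    ∃ d : (𝒜.α₁.obj R).carrier, ∀ (q : Space R) (hq : q ∉ W.carrier),
      c q (fun h => hq (hW h)) = algebraMap _ _ d

theorem IsGood.op {R : Alg 𝒜.σ.toAlgType} {Z : CptClosed (Space R)}
    {c c' c'' : ∀ p : Space R, p ∉ Z.carrier → Localization p.asIdeal.primeCompl}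
    (hc : IsGood Z c) (hc' : IsGood Z c')
    (H : ∀ d d' : (𝒜.α₁.obj R).carrier, ∃ d'' : (𝒜.α₁.obj R).carrier, ∀ p hp,
      c p hp = algebraMap _ _ d → c' p hp = algebraMap _ _ d' → c'' p hp = algebraMap _ _ d'') :
    IsGood Z c'' := by
  intro p hp
  obtain ⟨W, hW, hpW, d, hd⟩ := hc p hp
  obtain ⟨W', hW', hpW', d', hd'⟩ := hc' p hp
  obtain ⟨d'', h⟩ := H d d'
  refine ⟨W * W', (CptClosed.mul_le_left _ _).trans hW, fun h => h.elim hpW hpW', d'',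
    fun q hq => h q _ ?_ ?_⟩
  · exact hd q fun h => hq (CptClosed.mul_le_left W W' h)
  · exact hd' q fun h => hq (CptClosed.mul_le_right W W' h)

theorem IsGood.closed_compact {R : Alg 𝒜.σ.toAlgType} {Z : CptClosed (Space R)}
    {c : ∀ p : Space R, p ∉ Z.carrier → Localization p.asIdeal.primeCompl} (hc : IsGood Z c) :
    IsClosed {p | ∀ hp : p ∉ Z.carrier, c p hp ≠ 1} ∧
      IsCompact {p | ∀ hp : p ∉ Z.carrier, c p hp ≠ 1}ᶜ := by
  choose W hW hpW d hd using hc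
  set K : Set (Space R) := {p | ∀ hp : p ∉ Z.carrier, c p hp ≠ 1}
  have hK : ∀ p hp q, q ∉ (W p hp).carrier → (q ∈ Kᶜ ↔ q ∉ (V (d p hp)).carrier) := by
    intro p hp q hq
    rw [mem_V, ← algebraMap_primeCompl_eq_one, ← hd p hp q hq]
    constructor
    · intro h
      by_contra h'
      exact h fun _ => h'
    · exact fun h h' => h' _ h
  have hsub : ∀ p hp, (W p hp * V (d p hp)).carrierᶜ ⊆ Kᶜ := by
    intro p hp q hq
    have hq' := not_or.1 hq
    exact (hK p hp q hq'.1).2 hq'.2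
  have hZ : ∀ q ∈ Kᶜ, q ∉ Z.carrier := fun q hq h => hq fun h' => absurd h h'
  constructor
  · rw [← isOpen_compl_iff]
    have : Kᶜ = ⋃ p : {p : Space R // p ∉ Z.carrier},
        (W p.1 p.2 * V (d p.1 p.2)).carrierᶜ := by
      refine Set.Subset.antisymm (fun q hq => ?_) (Set.iUnion_subset fun p => hsub p.1 p.2)
      refine Set.mem_iUnion.2 ⟨⟨q, hZ q hq⟩, ?_⟩
      exact not_or.2 ⟨hpW q _, (hK q _ q (hpW q _)).1 hq⟩
    rw [this]
    exact isOpen_iUnion fun p => (W p.1 p.2 * V (d p.1 p.2)).isClosed.isOpen_compl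
  · obtain ⟨t, ht⟩ := Z.isCompact_compl.elim_finite_subcover
      (fun p : {p : Space R // p ∉ Z.carrier} => (W p.1 p.2).carrierᶜ)
      (fun p => (W p.1 p.2).isClosed.isOpen_compl)
      (fun p hp => Set.mem_iUnion.2 ⟨⟨p, hp⟩, hpW p hp⟩)
    have : Kᶜ = ⋃ p ∈ t, (W p.1 p.2 * V (d p.1 p.2)).carrierᶜ := by
      refine Set.Subset.antisymm (fun q hq => ?_) (Set.iUnion₂_subset fun p _ => hsub p.1 p.2)
      obtain ⟨p, hpt, hqp⟩ := Set.mem_iUnion₂.1 (ht (hZ q hq))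
      exact Set.mem_iUnion₂.2 ⟨p, hpt, not_or.2 ⟨hqp, (hK p.1 p.2 q hqp).1 hq⟩⟩
    rw [this]
    exact t.isCompact_biUnion fun p _ => (W p.1 p.2 * V (d p.1 p.2)).isCompact_compl

/-- The values of `y ∈ α₁(O_X(Z))` under `α₁(O_X(Z)) → α₁(R_p) → α₁(R)_p`. -/
def betaVal {R : Alg 𝒜.σ.toAlgType} {Z : CptClosed (Space R)} (p : Space R) (hp : p ∉ Z.carrier) :
    (𝒜.α₁.obj (sections Z)).carrier →+* Localization p.asIdeal.primeCompl :=
  (stalkBeta p).comp (PIIRng.hom (𝒜.α₁.map (ev hp)))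

theorem isGood_betaVal (h𝒜 : 𝒜.WeakPatching) {R : Alg 𝒜.σ.toAlgType} {Z : CptClosed (Space R)}
    (y : (𝒜.α₁.obj (sections Z)).carrier) : IsGood Z fun p hp => betaVal p hp y := by
  have hy : y ∈ Subsemiring.closure (Set.range (𝒜.α₂ (sections Z))) := by
    rw [h𝒜.generates]
    exact Subsemiring.mem_top y
  induction hy using Subsemiring.closure_induction with
  | mem y h =>
    obtain ⟨a, rfl⟩ := h
    intro p hp
    obtain ⟨W, hW, hpW, b, hb⟩ := a.2 ⟨p, hp⟩
    obtain ⟨d, hd⟩ := IsPIIRng.algebraMap_surjective _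
      ((𝒜.γ R (secMon W)).symm (𝒜.α₂ _ b))
    refine ⟨W, hW, hpW, d, fun q hq => ?_⟩
    rw [← stalkBeta_germ (𝒜.α₂ _ b) d hd.symm hq, 𝒜.α₂_natural, ← hb q hq]
    exact congrArg (stalkBeta q) (𝒜.α₂_natural (ev fun h => hq (hW h)) a)
  | zero => exact fun p hp => ⟨Z, le_rfl, hp, 0, fun q hq =>
    (map_zero (betaVal q _)).trans (map_zero _).symm⟩
  | one => exact fun p hp => ⟨Z, le_rfl, hp, 1, fun q hq =>
    (map_one (betaVal q _)).trans (map_one _).symm⟩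
  | add x y _ _ hx hy =>
    exact hx.op hy fun d d' => ⟨d + d', fun p hp h h' => by rw [map_add, map_add, h, h']⟩
  | mul x y _ _ hx hy =>
    exact hx.op hy fun d d' => ⟨d * d', fun p hp h h' => by rw [map_mul, map_mul, h, h']⟩

/-- The compact closed set attached to an element of `α₁(O_X(Z))`. -/
def betaSet (h𝒜 : 𝒜.WeakPatching) {R : Alg 𝒜.σ.toAlgType} {Z : CptClosed (Space R)}
    (y : (𝒜.α₁.obj (sections Z)).carrier) : CptClosed (Space R) where
  carrier := {p | ∀ hp : p ∉ Z.carrier, betaVal p hp y ≠ 1}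
  isClosed := (isGood_betaVal h𝒜 y).closed_compact.1
  isCompact_compl := (isGood_betaVal h𝒜 y).closed_compact.2

/-- The map `β_X` on sections over `Z`. -/
def betaApp (h𝒜 : 𝒜.WeakPatching) {R : Alg 𝒜.σ.toAlgType} (Z : (CptClosed (Space R))ᵒᵖ) :
    (𝒜.α₁.obj (sections Z.unop)).carrier →+* ((tau (Space R)).obj Z).carrier where
  toFun y := toTau Z (betaSet h𝒜 y)
  map_zero' := by
    rw [← map_zero (toTau Z)]
    refine congrArg _ (CptClosed.ext (Set.eq_univ_of_forall fun p hp => ?_))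
    rw [map_zero]
    exact zero_ne_one_stalk p
  map_one' := by
    rw [← toTau_self Z]
    refine congrArg _ (CptClosed.ext (Set.ext fun p => ?_))
    constructor
    · intro h
      by_contra hp
      exact h hp (map_one _)
    · exact fun h hp => absurd h hp
  map_add' x y := by
    rw [← map_add]
    refine congrArg _ (CptClosed.ext (Set.ext fun p => ?_))
    change (∀ hp, betaVal p hp (x + y) ≠ 1) ↔
      (∀ hp, betaVal p hp x ≠ 1) ∧ ∀ hp, betaVal p hp y ≠ 1
    rw [← forall_and]
    refine forall_congr' fun hp => ?_
    rw [map_add, Ne, add_eq_one_iff, not_or]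
  map_mul' x y := by
    rw [← map_mul]
    refine congrArg _ (CptClosed.ext (Set.ext fun p => ?_))
    change (∀ hp, betaVal p hp (x * y) ≠ 1) ↔
      (∀ hp, betaVal p hp x ≠ 1) ∨ ∀ hp, betaVal p hp y ≠ 1
    by_cases hp : p ∈ Z.unop.carrier
    · exact ⟨fun _ => Or.inl fun h => absurd hp h, fun _ h => absurd hp h⟩
    · rw [forall_prop_of_true hp, forall_prop_of_true hp, forall_prop_of_true hp, map_mul, Ne,
        mul_eq_one_iff, not_and_or]

/-- The comparison map `β_X : α₁ ∘ O_X ⟶ τ'_X` of `X = Spec R`. -/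
def beta (h𝒜 : 𝒜.WeakPatching) (R : Alg 𝒜.σ.toAlgType) :
    structureSheaf R ⋙ 𝒜.α₁ ⟶ tau (Space R) where
  app Z := betaApp h𝒜 Z
  naturality Z W h := RingHom.ext fun y => by
    change toTau W (betaSet h𝒜 (PIIRng.hom (𝒜.α₁.map ((structureSheaf R).map h)) y)) =
      PIIRng.hom ((tau (Space R)).map h) (toTau Z (betaSet h𝒜 y))
    rw [tau_map_toTau, ← mul_one (toTau W (betaSet h𝒜 y)), ← toTau_self W, ← map_mul]
    refine congrArg _ (CptClosed.ext (Set.ext fun p => ?_))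
    change (∀ hp : p ∉ W.unop.carrier, betaVal p hp
      (PIIRng.hom (𝒜.α₁.map ((structureSheaf R).map h)) y) ≠ 1) ↔
      (∀ hp : p ∉ Z.unop.carrier, betaVal p hp y ≠ 1) ∨ p ∈ W.unop.carrier
    by_cases hp : p ∈ W.unop.carrier
    · exact ⟨fun _ => Or.inr hp, fun _ h => absurd hp h⟩
    · have hp' : p ∉ Z.unop.carrier := fun h' => hp (leOfHom h.unop h')
      rw [forall_prop_of_true hp, forall_prop_of_true hp', or_iff_left hp]
      have : betaVal p hp (PIIRng.hom (𝒜.α₁.map ((structureSheaf R).map h)) y) =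
          betaVal p hp' y := by
        refine congrArg (stalkBeta p) ?_
        exact (congrArg (fun t => PIIRng.hom t y)
          (𝒜.α₁.map_comp ((structureSheaf R).map h) (ev hp))).symm
      rw [this]

end Spec

namespace Spec

variable {𝒜 : SchematizableType.{u}}

/-- Under the weak patching condition, `x` is invertible if `α₂(x) = 1`. -/
theorem isUnit_of_α₂_eq_one (h𝒜 : 𝒜.WeakPatching) {R : Alg 𝒜.σ.toAlgType} {x : R.carrier}
    (hx : 𝒜.α₂ R x = 1) : IsUnit x := by
  have hux : IsUnit (Loc.ι R (Submonoid.powers x) x) := Loc.isUnit_ι (Submonoid.mem_powers x)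
  have key : ∀ a : (Loc R (Submonoid.powers x)).carrier,
      ∃! b : R.carrier, Loc.ι R (Submonoid.powers x) b = a := by
    intro a
    have := h𝒜.patch R 0 (fun _ => x) (by simpa using hx) (fun _ => a) (fun i j => by
      have e : Loc.awayLeft x x = Loc.awayRight x x := rfl
      exact congrArg (fun t => AlgHom.toFun t a) e)
    obtain ⟨b, hb, hb'⟩ := this
    exact ⟨b, hb 0, fun c hc => hb' c fun _ => hc⟩
  obtain ⟨y, hy, -⟩ := key (hux.unit⁻¹ : (Loc R (Submonoid.powers x)).carrierˣ)
  refine IsUnit.of_mul_eq_one y ((key 1).unique ?_ ?_)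
  · change Alg.toMonoidHom (Loc.ι R (Submonoid.powers x)) (x * y) = 1
    rw [map_mul]
    change Loc.ι R _ x * Loc.ι R _ y = 1
    rw [hy]
    exact hux.mul_val_inv
  · exact map_one (Alg.toMonoidHom (Loc.ι R (Submonoid.powers x)))

/-- The sets `D(α₂(t))` form a basis of the topology. -/
theorem exists_basic (h𝒜 : 𝒜.WeakPatching) {R : Alg 𝒜.σ.toAlgType} {p : Space R}
    {W : CptClosed (Space R)} (hp : p ∉ W.carrier) :
    ∃ t : R.carrier, 𝒜.α₂ R t ∉ p.asIdeal ∧ V (𝒜.α₂ R t) ≤ W := by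
  obtain ⟨_, ⟨d, rfl⟩, hpd, hd⟩ :=
    PrimeSpectrum.isTopologicalBasis_basic_opens.exists_subset_of_mem_open
      (show p ∈ W.carrierᶜ from hp) W.isClosed.isOpen_compl
  have key : ∀ d : (𝒜.α₁.obj R).carrier, d ∉ p.asIdeal →
      ∃ t : R.carrier, 𝒜.α₂ R t ∉ p.asIdeal ∧ IsPIIRng.LE (𝒜.α₂ R t) d := by
    intro d
    have hd : d ∈ Subsemiring.closure (Set.range (𝒜.α₂ R)) := by
      rw [h𝒜.generates]
      exact Subsemiring.mem_top d
    induction hd using Subsemiring.closure_induction with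
    | mem y h =>
      obtain ⟨t, rfl⟩ := h
      exact fun h => ⟨t, h, IsPIIRng.add_self _⟩
    | zero => exact fun h => absurd p.asIdeal.zero_mem h
    | one =>
      refine fun h => ⟨1, by rwa [map_one], ?_⟩
      change 𝒜.α₂ R 1 + 1 = 1
      rw [add_comm, IsPIIRng.one_add]
    | add x y _ _ hx hy =>
      intro h
      rw [add_mem_iff, not_and_or] at h
      rcases h with h | h
      · obtain ⟨t, ht, ht'⟩ := hx h
        refine ⟨t, ht, ?_⟩
        change _ + (x + y) = x + y
        rw [← add_assoc]
        exact congrArg (fun z => z + y) ht'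
      · obtain ⟨t, ht, ht'⟩ := hy h
        refine ⟨t, ht, ?_⟩
        change _ + (x + y) = x + y
        rw [add_left_comm]
        exact congrArg (fun z => x + z) ht'
    | mul x y _ _ hx hy =>
      intro h
      obtain ⟨t, ht, ht'⟩ := hx fun h' => h (p.asIdeal.mul_mem_right y h')
      obtain ⟨s, hs, hs'⟩ := hy fun h' => h (p.asIdeal.mul_mem_left x h')
      refine ⟨t * s, ?_, ?_⟩
      · rw [map_mul]
        exact fun h' => (p.isPrime.mem_or_mem h').elim ht hs
      · rw [IsPIIRng.LE_iff_mul] at ht' hs' ⊢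
        rw [map_mul, mul_mul_mul_comm, ht', hs']
  obtain ⟨t, ht, htd⟩ := key d hpd
  refine ⟨t, ht, fun q hq => ?_⟩
  rw [mem_V]
  by_contra h
  refine hd ?_ hq
  intro hdq
  rw [← IsPIIRng.LE_iff_mul.1 htd] at h
  exact h (q.asIdeal.mul_mem_left _ hdq)

/-- If every prime ideal that contains `d` contains `e`, then `e ≤ d`. -/
theorem mul_eq_of_forall {D : PIIRng.{u}} {d e : D.carrier}
    (h : ∀ q : PrimeSpectrum D.carrier, e ∉ q.asIdeal → d ∉ q.asIdeal) : e * d = e := by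
  have h1 : PrimeSpectrum.zeroLocus {d} ⊆ PrimeSpectrum.zeroLocus {e} := fun q hq => by
    rw [PrimeSpectrum.mem_zeroLocus, Set.singleton_subset_iff] at hq ⊢
    by_contra h'
    exact h q h' hq
  rw [PrimeSpectrum.zeroLocus_subset_zeroLocus_singleton_iff] at h1
  obtain ⟨n, hn⟩ := h1
  obtain ⟨c, hc⟩ := Ideal.mem_span_singleton.1 hn
  have h2 : e * e ^ n = e := by
    rw [← pow_succ']
    exact IsIdempotentElem.pow_succ_eq n (IsPIIRng.mul_self e)
  have h3 : e = e * (d * c) := by rw [← hc, h2]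
  calc e * d = e * (d * c) * d := by rw [← h3]
    _ = e * ((d * d) * c) := by rw [mul_assoc, mul_right_comm d c d]
    _ = e := by rw [IsPIIRng.mul_self, ← h3]

theorem notMem_of_mem_powers {R : Alg 𝒜.σ.toAlgType} {Z c : CptClosed (Space R)}
    (hc : c ∈ Submonoid.powers Z) {q : Space R} (hq : q ∉ Z.carrier) : q ∉ c.carrier := by
  obtain ⟨n, rfl⟩ := hc
  induction n with
  | zero =>
    change q ∉ (Z ^ 0).carrier
    rw [pow_zero]
    exact fun h => h
  | succ n ih =>
    change q ∉ (Z ^ (n + 1)).carrier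
    rw [pow_succ]
    exact fun h => h.elim ih hq

theorem betaVal_eq_one_of_le (h𝒜 : 𝒜.WeakPatching) {R : Alg 𝒜.σ.toAlgType}
    {Z W : CptClosed (Space R)} (h : W ≤ Z) (y : (𝒜.α₁.obj (sections Z)).carrier)
    (hy : IsPIIRng.LE (toTau (op Z) W) (betaApp h𝒜 (op Z) y)) (q : Space R) (hq : q ∉ W.carrier) :
    betaVal q (fun h' => hq (h h')) y = 1 := by
  have hy' : toTau (op Z) (W + betaSet h𝒜 y) = toTau (op Z) (betaSet h𝒜 y) :=
    (map_add (toTau (op Z)) _ _).trans hy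
  obtain ⟨c, hc⟩ := (IsLocalization.eq_iff_exists (Submonoid.powers Z)
    (Localization (Submonoid.powers Z))).1 hy'
  have hqZ : q ∉ Z.carrier := fun h' => hq (h h')
  have hqc := notMem_of_mem_powers c.2 hqZ
  by_contra hne
  have h1 : q ∈ (c.1 * betaSet h𝒜 y).carrier := Or.inr fun _ => hne
  have h2 : q ∈ (c.1 * (W + betaSet h𝒜 y)).carrier := by
    rw [hc]
    exact h1
  exact h2.elim hqc fun h3 => hq h3.1

/-- Locally around `p ∉ W`, a section `a` with `β(α₂(a)) ≥ W` comes from an invertible element. -/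
theorem exists_isUnit (h𝒜 : 𝒜.WeakPatching) {R : Alg 𝒜.σ.toAlgType}
    {Z W : CptClosed (Space R)} (h : W ≤ Z) (a : (sections Z).carrier)
    (ha : IsPIIRng.LE (toTau (op Z) W) (betaApp h𝒜 (op Z) (𝒜.α₂ (sections Z) a))) (p : Space R)
    (hp : p ∉ W.carrier) :
    ∃ (U : CptClosed (Space R)) (hU : U ≤ W), p ∉ U.carrier ∧
      ∃ b : (Loc R (secMon U)).carrier, IsUnit b ∧
        ∀ (q : Space R) (hq : q ∉ U.carrier), ev (fun h' => hq (hU (h h'))) a = germ hq b := by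
  obtain ⟨T, hT, hpT, b, hb⟩ := a.2 ⟨p, fun h' => hp (h h')⟩
  obtain ⟨t, htp, ht⟩ := exists_basic h𝒜 (W := T * W) (fun h' => h'.elim hpT hp)
  have hUT := ht.trans (CptClosed.mul_le_left T W)
  have hb' : ∀ (q : Space R) (hq : q ∉ (V (𝒜.α₂ R t)).carrier),
      ev (fun h' => hq (ht.trans (CptClosed.mul_le_right T W) (h h'))) a =
        germ hq (Loc.res (secMon_mono hUT) b) := fun q hq => by
    rw [germ_res hUT]
    exact hb q _
  refine ⟨V (𝒜.α₂ R t), ht.trans (CptClosed.mul_le_right T W), fun h' => htp ((mem_V _ _).1 h'),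
    Loc.res (secMon_mono hUT) b, ?_, hb'⟩
  apply isUnit_of_α₂_eq_one h𝒜
  set b' := Loc.res (secMon_mono hUT) b
  obtain ⟨d, hd⟩ := IsPIIRng.algebraMap_surjective _
    ((𝒜.γ R (secMon (V (𝒜.α₂ R t)))).symm (𝒜.α₂ _ b'))
  have hd1 : 𝒜.α₂ R t * d = 𝒜.α₂ R t := mul_eq_of_forall fun q hq => by
    have hq' : q ∉ (V (𝒜.α₂ R t)).carrier := fun h' => hq ((mem_V _ _).1 h')
    rw [← algebraMap_primeCompl_eq_one, ← stalkBeta_germ (𝒜.α₂ _ b') d hd.symm hq',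
      𝒜.α₂_natural, ← hb' q hq']
    refine Eq.trans ?_ (betaVal_eq_one_of_le h𝒜 h _ ha q
      fun h' => hq' (ht.trans (CptClosed.mul_le_right T W) h'))
    exact congrArg (stalkBeta q) (𝒜.α₂_natural _ a).symm
  have ht1 : algebraMap (𝒜.α₁.obj R).carrier
      (Localization ((secMon (V (𝒜.α₂ R t))).map (𝒜.α₂ R))) (𝒜.α₂ R t) = 1 :=
    IsPIIRng.algebraMap_eq_one ⟨t, le_refl (V (𝒜.α₂ R t)), rfl⟩
  have hd2 : algebraMap (𝒜.α₁.obj R).carrier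
      (Localization ((secMon (V (𝒜.α₂ R t))).map (𝒜.α₂ R))) d = 1 := by
    rw [← one_mul (algebraMap _ _ d), ← ht1, ← map_mul, hd1]
  rw [hd2] at hd
  rw [← RingEquiv.apply_symm_apply (𝒜.γ R (secMon (V (𝒜.α₂ R t)))) (𝒜.α₂ _ b'), ← hd, map_one]

/-- A section `a` with `β(α₂(a)) ≥ W` is invertible over `W`. -/
theorem isUnit_res (h𝒜 : 𝒜.WeakPatching) {R : Alg 𝒜.σ.toAlgType}
    {Z W : CptClosed (Space R)} (h : W ≤ Z) (a : (sections Z).carrier)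
    (ha : IsPIIRng.LE (toTau (op Z) W) (betaApp h𝒜 (op Z) (𝒜.α₂ (sections Z) a))) :
    IsUnit (M := (sections W).carrier) ((structureSheaf R).map (homOfLE h).op a) := by
  have hu : ∀ q : {q : Space R // q ∉ W.carrier}, IsUnit (ev (fun h' => q.2 (h h')) a) := fun q => by
    obtain ⟨U, hU, hqU, b, hb, hab⟩ := exists_isUnit h𝒜 h a ha q.1 q.2
    rw [hab q.1 hqU]
    exact hb.map (Alg.toMonoidHom (germ hqU))
  let r : ∀ q : {q : Space R // q ∉ W.carrier}, (Loc R (stalkMon q.1)).carrier := fun q =>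
    ((hu q).unit⁻¹ : (Loc R (stalkMon q.1)).carrierˣ)
  have hr : IsLocallyFraction W r := fun p => by
    obtain ⟨U, hU, hqU, b, hb, hab⟩ := exists_isUnit h𝒜 h a ha p.1 p.2
    refine ⟨U, hU, hqU, (hb.unit⁻¹ : (Loc R (secMon U)).carrierˣ), fun q hq => ?_⟩
    refine (hu ⟨q, fun h' => hq (hU h')⟩).mul_left_cancel ?_
    refine (hu ⟨q, fun h' => hq (hU h')⟩).mul_val_inv.trans ?_
    rw [hab q hq]
    have := congrArg (Alg.toMonoidHom (germ hq)) hb.mul_val_inv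
    rw [map_mul, map_one] at this
    exact this.symm
  refine IsUnit.of_mul_eq_one (⟨r, hr⟩ : (sections W).carrier) (sections_ext fun q hq => ?_)
  refine (map_mul (Alg.toMonoidHom (ev hq)) _ _).trans
    (Eq.trans ?_ (map_one (Alg.toMonoidHom (ev hq))).symm)
  exact (hu ⟨q, hq⟩).mul_val_inv

/-- The `𝒜`-scheme `Spec R`. -/
def obj (h𝒜 : 𝒜.WeakPatching) (R : Alg 𝒜.σ.toAlgType) : Scheme 𝒜 where
  carrier := Space R
  O := structureSheaf R
  isSheaf := isSheaf_structureSheaf R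
  β := beta h𝒜 R
  reflects Z W h a ha := by
    have hu := isUnit_res h𝒜 h a ha
    refine ⟨Loc.lift ((structureSheaf R).map (homOfLE h).op) ?_, rfl⟩
    rintro _ ⟨n, rfl⟩
    change IsUnit (Alg.toMonoidHom ((structureSheaf R).map (homOfLE h).op) (a ^ n))
    rw [map_pow]
    exact hu.pow n

end Spec

/-! ### The sheaf property of `τ'` and finite covers -/

section tauSheaf

variable {X : Type u} [TopologicalSpace X] [SpectralSpace X]

theorem toTau_eq_iff {Z : (CptClosed X)ᵒᵖ} {K K' : CptClosed X} :
    toTau Z K = toTau Z K' ↔ K * Z.unop = K' * Z.unop := by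
  constructor
  · intro h
    obtain ⟨⟨_, n, rfl⟩, hc⟩ := (IsLocalization.eq_iff_exists (Submonoid.powers Z.unop)
      (Localization (Submonoid.powers Z.unop))).1 h
    have hc' : Z.unop ^ n * K = Z.unop ^ n * K' := hc
    have hn : Z.unop * Z.unop ^ n = Z.unop := by
      rw [← pow_succ']
      exact IsIdempotentElem.pow_succ_eq n (IsPIIRng.mul_self Z.unop)
    rw [mul_comm K, mul_comm K', ← hn, mul_assoc, hc', mul_assoc]
  · intro h
    have := congrArg (toTau Z) h
    rwa [map_mul, map_mul, toTau_self, mul_one, mul_one] at this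

theorem toTau_surjective (Z : (CptClosed X)ᵒᵖ) : Function.Surjective (toTau Z) :=
  IsPIIRng.algebraMap_surjective _

theorem PIIRng.isPullback_of {P A B C : PIIRng.{u}} {f : P ⟶ A} {g : P ⟶ B} {h : A ⟶ C}
    {k : B ⟶ C} (comm : f ≫ h = g ≫ k)
    (H : ∀ a b, hom h a = hom k b → ∃! p, hom f p = a ∧ hom g p = b) : IsPullback f g h k := by
  have hs : ∀ (s : Limits.PullbackCone h k) x, hom h (hom s.fst x) = hom k (hom s.snd x) :=
    fun s x => congrArg (fun t => hom t x) s.condition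
  refine ⟨⟨comm⟩, ⟨Limits.PullbackCone.IsLimit.mk comm (fun s => ?_) (fun s => ?_) (fun s => ?_)
    (fun s m h1 h2 => ?_)⟩⟩
  · exact
      { toFun := fun x => (H _ _ (hs s x)).choose
        map_one' := ((H _ _ (hs s 1)).choose_spec.2 _ (by simp only [map_one, and_self])).symm
        map_zero' := ((H _ _ (hs s 0)).choose_spec.2 _ (by simp only [map_zero, and_self])).symm
        map_add' := fun x y => ((H _ _ (hs s (x + y))).choose_spec.2 _ (by
          simp only [map_add, (H _ _ (hs s x)).choose_spec.1, (H _ _ (hs s y)).choose_spec.1,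
            and_self])).symm
        map_mul' := fun x y => ((H _ _ (hs s (x * y))).choose_spec.2 _ (by
          simp only [map_mul, (H _ _ (hs s x)).choose_spec.1, (H _ _ (hs s y)).choose_spec.1,
            and_self])).symm }
  · exact RingHom.ext fun x => (H _ _ (hs s x)).choose_spec.1.1
  · exact RingHom.ext fun x => (H _ _ (hs s x)).choose_spec.1.2
  · refine RingHom.ext fun x => (H _ _ (hs s x)).choose_spec.2 _ ⟨?_, ?_⟩
    · exact congrArg (fun t => hom t x) h1
    · exact congrArg (fun t => hom t x) h2

variable (X) in
/-- `τ'_X` is a sheaf. -/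
theorem isSheaf_tau : IsSheafCpt (tau X) := by
  constructor
  · have h01 : (0 : ((tau X).obj (op 0)).carrier) = 1 := by
      rw [← map_zero (toTau (op 0))]
      exact toTau_self (op (0 : CptClosed X))
    have hsub : ∀ x y : ((tau X).obj (op 0)).carrier, x = y := fun x y => by
      rw [← mul_one x, ← mul_one y, ← h01, mul_zero, mul_zero]
    refine ⟨Limits.IsTerminal.ofUniqueHom (fun A => ?_) (fun A m => ?_)⟩
    · exact
        { toFun := fun _ => 0
          map_one' := hsub _ _
          map_zero' := rfl
          map_add' := fun _ _ => hsub _ _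
          map_mul' := fun _ _ => hsub _ _ }
    · exact RingHom.ext fun _ => hsub _ _
  · intro Z₁ Z₂
    refine PIIRng.isPullback_of (((tau X).map_comp _ _).symm.trans
      ((congrArg (tau X).map (Subsingleton.elim _ _)).trans ((tau X).map_comp _ _)))
      fun a b hab => ?_
    obtain ⟨K₁, rfl⟩ := toTau_surjective (op Z₁) a
    obtain ⟨K₂, rfl⟩ := toTau_surjective (op Z₂) b
    rw [tau_map_toTau, tau_map_toTau, toTau_eq_iff] at hab
    have hab' : K₁ * (Z₁ * Z₂) = K₂ * (Z₁ * Z₂) := hab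
    refine ⟨toTau _ (K₁ * Z₁ + K₂ * Z₂), ⟨?_, ?_⟩, ?_⟩
    · rw [tau_map_toTau, toTau_eq_iff]
      change (K₁ * Z₁ + K₂ * Z₂) * Z₁ = K₁ * Z₁
      calc (K₁ * Z₁ + K₂ * Z₂) * Z₁ = K₁ * (Z₁ * Z₁) + K₂ * (Z₁ * Z₂) := by ring
        _ = K₁ * Z₁ * (1 + Z₂) := by rw [← hab', IsPIIRng.mul_self]; ring
        _ = K₁ * Z₁ := by rw [IsPIIRng.one_add, mul_one]
    · rw [tau_map_toTau, toTau_eq_iff]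
      change (K₁ * Z₁ + K₂ * Z₂) * Z₂ = K₂ * Z₂
      calc (K₁ * Z₁ + K₂ * Z₂) * Z₂ = K₁ * (Z₁ * Z₂) + K₂ * (Z₂ * Z₂) := by ring
        _ = K₂ * Z₂ * (1 + Z₁) := by rw [hab', IsPIIRng.mul_self]; ring
        _ = K₂ * Z₂ := by rw [IsPIIRng.one_add, mul_one]
    · rintro y ⟨h₁, h₂⟩
      obtain ⟨K, rfl⟩ := toTau_surjective _ y
      rw [tau_map_toTau, toTau_eq_iff] at h₁ h₂
      have h₁' : K * Z₁ = K₁ * Z₁ := h₁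
      have h₂' : K * Z₂ = K₂ * Z₂ := h₂
      rw [toTau_eq_iff]
      change K * (Z₁ + Z₂) = (K₁ * Z₁ + K₂ * Z₂) * (Z₁ + Z₂)
      rw [← h₁', ← h₂', ← mul_add, mul_assoc, IsPIIRng.mul_self]

end tauSheaf

namespace Spec

variable {𝒜 : SchematizableType.{u}}

/-- The restriction of `β_X` along `α₁ ∘ O' ⟶ α₁ ∘ O` is the composition of
`γ⁻¹ : α₁(R_Z) ≃ α₁(R)_{α₂(S)}`, where `S = {x ∣ α₂(x) ≥ Z}`, and of the map
`α₁(R)_{α₂(S)} → C(X)_{cpt,Z}` induced by `d ↦ V(d)`. -/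
theorem beta_toStructureSheaf (h𝒜 : 𝒜.WeakPatching) (R : Alg 𝒜.σ.toAlgType)
    (Z : (CptClosed (Space R))ᵒᵖ) (y : (𝒜.α₁.obj (Loc R (secMon Z.unop))).carrier)
    (d : (𝒜.α₁.obj R).carrier)
    (hd : (𝒜.γ R (secMon Z.unop)).symm y = algebraMap (𝒜.α₁.obj R).carrier _ d) :
    PIIRng.hom ((beta h𝒜 R).app Z) (PIIRng.hom (𝒜.α₁.map ((toStructureSheaf R).app Z)) y) =
      toTau Z (V d) := by
  refine toTau_eq_iff.2 (CptClosed.ext (Set.ext fun p => or_congr_left' fun hp => ?_))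
  refine Iff.trans ?_ (mem_V d p).symm
  change (∀ hp : p ∉ Z.unop.carrier, betaVal p hp
    (PIIRng.hom (𝒜.α₁.map ((toStructureSheaf R).app Z)) y) ≠ 1) ↔ _
  have e : betaVal p hp (PIIRng.hom (𝒜.α₁.map ((toStructureSheaf R).app Z)) y) =
      algebraMap (𝒜.α₁.obj R).carrier _ d :=
    (congrArg (stalkBeta p) (congrArg (fun t => PIIRng.hom t y)
      (𝒜.α₁.map_comp ((toStructureSheaf R).app Z) (ev hp)).symm)).trans
      (stalkBeta_germ y d hd hp)
  rw [forall_prop_of_true hp, e, Ne, algebraMap_primeCompl_eq_one, not_not]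

/-- `β_X` is determined by its restriction along `α₁ ∘ O' ⟶ α₁ ∘ O`. -/
theorem beta_unique (h𝒜 : 𝒜.WeakPatching) (R : Alg 𝒜.σ.toAlgType)
    (b b' : structureSheaf R ⋙ 𝒜.α₁ ⟶ tau (Space R))
    (H : ∀ Z y, PIIRng.hom (b.app Z) (PIIRng.hom (𝒜.α₁.map ((toStructureSheaf R).app Z)) y) =
      PIIRng.hom (b'.app Z) (PIIRng.hom (𝒜.α₁.map ((toStructureSheaf R).app Z)) y)) : b = b' := by
  ext Z : 2
  refine RingHom.eq_of_eqOn_sdense (s := Set.range (𝒜.α₂ (sections Z.unop)))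
    (h𝒜.generates _) ?_
  rintro _ ⟨a, rfl⟩
  obtain ⟨K, hK⟩ := toTau_surjective Z (PIIRng.hom (b.app Z) (𝒜.α₂ (sections Z.unop) a))
  obtain ⟨K', hK'⟩ := toTau_surjective Z (PIIRng.hom (b'.app Z) (𝒜.α₂ (sections Z.unop) a))
  refine hK.symm.trans (Eq.trans ?_ hK')
  refine toTau_eq_iff.2 (CptClosed.ext (Set.ext fun p => or_congr_left' fun hp => ?_))
  obtain ⟨W, hW, hpW, c, hc⟩ := a.2 ⟨p, hp⟩
  have hres : (structureSheaf R).map (homOfLE hW).op a = (toStructureSheaf R).app (op W) c :=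
    sections_ext fun q hq => hc q hq
  have key : ∀ g : structureSheaf R ⋙ 𝒜.α₁ ⟶ tau (Space R),
      PIIRng.hom ((tau (Space R)).map (homOfLE hW).op)
        (PIIRng.hom (g.app Z) (𝒜.α₂ (sections Z.unop) a)) =
      PIIRng.hom (g.app (op W)) (PIIRng.hom (𝒜.α₁.map ((toStructureSheaf R).app (op W)))
        (𝒜.α₂ _ c)) := fun g => by
    refine (congrArg (fun t => PIIRng.hom t (𝒜.α₂ (sections Z.unop) a))
      (g.naturality (homOfLE hW).op)).symm.trans ?_
    refine congrArg (PIIRng.hom (g.app (op W))) ?_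
    exact (𝒜.α₂_natural ((structureSheaf R).map (homOfLE hW).op) a).trans
      ((congrArg (𝒜.α₂ (sections W)) hres).trans
        (𝒜.α₂_natural ((toStructureSheaf R).app (op W)) c).symm)
  have h1 := (key b).trans ((H (op W) _).trans (key b').symm)
  rw [← hK, ← hK', tau_map_toTau, tau_map_toTau, toTau_eq_iff] at h1
  have h2 := congrArg (fun t : CptClosed (Space R) => p ∈ t.carrier) h1
  have h3 : (p ∈ K.carrier ∨ p ∈ W.carrier) ↔ (p ∈ K'.carrier ∨ p ∈ W.carrier) := iff_of_eq h2
  rwa [or_iff_left hpW, or_iff_left hpW] at h3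

end Spec

namespace Spec

/-! ### Functoriality of the spectrum -/

variable {𝒜 : SchematizableType.{u}} {A B C : Alg 𝒜.σ.toAlgType}

/-- The continuous map `Spec φ : Spec A → Spec B` of a homomorphism `φ : B ⟶ A`. -/
def base (φ : B ⟶ A) : Space A → Space B := PrimeSpectrum.comap (PIIRng.hom (𝒜.α₁.map φ))

theorem mem_base (φ : B ⟶ A) (p : Space A) (d : (𝒜.α₁.obj B).carrier) :
    d ∈ (base φ p).asIdeal ↔ PIIRng.hom (𝒜.α₁.map φ) d ∈ p.asIdeal := Iff.rfl

theorem isSpectralMap_base (φ : B ⟶ A) : IsSpectralMap (base φ) where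
  toContinuous := PrimeSpectrum.continuous_comap _
  isCompact_preimage_of_isOpen s hs hs' := by
    classical
    obtain ⟨t, rfl⟩ := PrimeSpectrum.isCompact_isOpen_iff.1 ⟨hs', hs⟩
    refine (PrimeSpectrum.isCompact_isOpen_iff.2
      ⟨t.image (PIIRng.hom (𝒜.α₁.map φ)), ?_⟩).1
    rw [Set.preimage_compl, Finset.coe_image]
    exact congrArg _ (PrimeSpectrum.preimage_comap_zeroLocus _ _).symm

theorem stalkMon_base (φ : B ⟶ A) {p : Space A} {q : Space B} (h : base φ p = q) :
    ∀ x ∈ stalkMon q, φ x ∈ stalkMon p := fun x hx hx' => by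
  refine hx ?_
  rw [← h, SetLike.mem_coe, mem_base, 𝒜.α₂_natural]
  exact hx'

theorem secMon_base (φ : B ⟶ A) (Z : CptClosed (Space B)) :
    ∀ x ∈ secMon Z, φ x ∈ secMon (CptClosed.comap (isSpectralMap_base φ) Z) :=
  fun x hx p hp => by
    rw [mem_V, ← 𝒜.α₂_natural, ← mem_base, ← mem_V] at hp
    exact hx hp

/-- The map `B_q ⟶ A_p` on stalks, where `q` is the image of `p`. -/
def stalkHom (φ : B ⟶ A) {p : Space A} {q : Space B} (h : base φ p = q) :
    Loc B (stalkMon q) ⟶ Loc A (stalkMon p) := Loc.map φ (stalkMon_base φ h)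

/-- The morphism of sheaves `O_Y ⟶ f_* O_X` over `Y = Spec B`, where `X = Spec A` and
`f = Spec φ`. It is induced by the maps `B_Z ⟶ A_{f⁻¹Z}`. -/
def sharp (φ : B ⟶ A) : structureSheaf B ⟶
    (CptClosed.comapFunctor (isSpectralMap_base φ)).op ⋙ structureSheaf A where
  app Z :=
    { toFun := fun s => ⟨fun p => stalkHom φ rfl (s.1 ⟨base φ p.1, p.2⟩), fun p => by
        obtain ⟨W, hW, hpW, b, hb⟩ := s.2 ⟨base φ p.1, p.2⟩
        refine ⟨CptClosed.comap (isSpectralMap_base φ) W, CptClosed.comap_mono _ hW, hpW,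
          Loc.map φ (secMon_base φ W) b, fun q hq => ?_⟩
        refine (congrArg (AlgHom.toFun (stalkHom φ rfl)) (hb (base φ q) hq)).trans ?_
        have e : germ (Z := W) (p := base φ q) hq ≫ stalkHom φ rfl =
            Loc.map φ (secMon_base φ W) ≫
              germ (Z := CptClosed.comap (isSpectralMap_base φ) W) (p := q) hq :=
          Loc.hom_ext fun _ => rfl
        exact congrArg (fun t => AlgHom.toFun t b) e⟩
      map_op := fun ω s => Subtype.ext (funext fun p => Alg.map_op (stalkHom φ rfl) ω _) }
  naturality _ _ _ := rfl

theorem stalkBeta_stalkHom (φ : B ⟶ A) (p : Space A)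
    (z : (𝒜.α₁.obj (Loc B (stalkMon (base φ p)))).carrier) :
    stalkBeta p (PIIRng.hom (𝒜.α₁.map (stalkHom φ (p := p) rfl)) z) = 1 ↔
      stalkBeta (base φ p) z = 1 := by
  obtain ⟨d, hd⟩ := IsPIIRng.algebraMap_surjective _ ((𝒜.γ B (stalkMon (base φ p))).symm z)
  have hz : z = 𝒜.γ B (stalkMon (base φ p)) (algebraMap (𝒜.α₁.obj B).carrier _ d) := by
    rw [hd, RingEquiv.apply_symm_apply]
  have h1 := 𝒜.γ_natural φ (stalkMon_base φ (p := p) rfl) (by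
    rintro _ ⟨x, hx, rfl⟩
    rw [𝒜.α₂_natural]
    exact ⟨φ x, stalkMon_base φ rfl x hx, rfl⟩) (algebraMap (𝒜.α₁.obj B).carrier _ d)
  rw [locMap_algebraMap] at h1
  have h2 := (congrArg (stalkBeta p) h1).trans (stalkBeta_γ p _)
  rw [hz, stalkBeta_γ, algebraMap_primeCompl_eq_one, mem_base, ← algebraMap_primeCompl_eq_one,
    ← h2]
  rfl

/-- The morphism of `𝒜`-schemes `Spec A ⟶ Spec B` of a homomorphism `φ : B ⟶ A`. -/
def map (h𝒜 : 𝒜.WeakPatching) (φ : B ⟶ A) : obj h𝒜 A ⟶ obj h𝒜 B where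
  base := base φ
  isSpectralMap := isSpectralMap_base φ
  sharp := sharp φ
  comm Z := RingHom.ext fun y => by
    refine (tauMap_toTau (isSpectralMap_base φ) Z (betaSet h𝒜 y)).trans ?_
    refine congrArg (toTau _) (CptClosed.ext (Set.ext fun p => ?_))
    refine forall_congr' fun hp => not_congr ?_
    refine (stalkBeta_stalkHom φ p (PIIRng.hom (𝒜.α₁.map (ev hp)) y)).symm.trans ?_
    have e : ev (Z := Z.unop) (p := base φ p) hp ≫ stalkHom φ rfl = (sharp φ).app Z ≫
        ev (Z := CptClosed.comap (isSpectralMap_base φ) Z.unop) (p := p) hp := rfl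
    have e' := (𝒜.α₁.map_comp _ _).symm.trans ((congrArg 𝒜.α₁.map e).trans (𝒜.α₁.map_comp _ _))
    exact Eq.congr_left (congrArg (stalkBeta p) (congrArg (fun t => PIIRng.hom t y) e'))

theorem sections_congr {Z : CptClosed (Space B)} (s : (sections Z).carrier) {q q' : Space B}
    (h : q = q') (hq : q ∉ Z.carrier) (hq' : q' ∉ Z.carrier) (φ : B ⟶ A) {p : Space A}
    (e : base φ p = q) (e' : base φ p = q') :
    stalkHom φ e (s.1 ⟨q, hq⟩) = stalkHom φ e' (s.1 ⟨q', hq'⟩) := by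
  subst h
  rfl

end Spec

/-- The spectrum functor. -/
def Spec (𝒜 : SchematizableType.{u}) (h𝒜 : 𝒜.WeakPatching) :
    Alg 𝒜.σ.toAlgType ⥤ (Scheme 𝒜)ᵒᵖ where
  obj R := op (Spec.obj h𝒜 R)
  map φ := (Spec.map h𝒜 φ).op
  map_id R := congrArg Quiver.Hom.op (by
    have hb : Spec.base (𝟙 R) = id := by
      change PrimeSpectrum.comap (PIIRng.hom (𝒜.α₁.map (𝟙 R))) = id
      rw [𝒜.α₁.map_id]
      rfl
    refine Scheme.Hom.ext' hb fun Z e => Alg.hom_ext fun s => Spec.sections_ext fun p hp => ?_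
    have h1 : Spec.base (𝟙 R) p = p := congrFun hb p
    have hp1 : Spec.base (𝟙 R) p ∉ Z.carrier := by rw [h1]; exact hp
    refine (Spec.sections_congr s h1 hp1 hp (𝟙 R) rfl h1).trans ?_
    exact congrArg (fun t => AlgHom.toFun t (s.1 ⟨p, hp⟩)) (Loc.map_id (S := Spec.stalkMon p) _))
  map_comp {R R' R''} φ ψ := congrArg Quiver.Hom.op (by
    have hb : Spec.base (φ ≫ ψ) = Spec.base φ ∘ Spec.base ψ := by
      change PrimeSpectrum.comap (PIIRng.hom (𝒜.α₁.map (φ ≫ ψ))) = _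
      rw [𝒜.α₁.map_comp]
      rfl
    refine Scheme.Hom.ext' hb fun Z e => Alg.hom_ext fun s => Spec.sections_ext fun p hp => ?_
    have h1 : Spec.base (φ ≫ ψ) p = Spec.base φ (Spec.base ψ p) := congrFun hb p
    have hp1 : Spec.base (φ ≫ ψ) p ∉ Z.carrier := by rw [h1]; exact hp
    refine (Spec.sections_congr s h1 hp1 hp (φ ≫ ψ) rfl h1).trans ?_
    exact congrArg (fun t => AlgHom.toFun t (s.1 ⟨_, hp⟩))
      (Loc.map_comp φ (Spec.stalkMon_base φ rfl) ψ (Spec.stalkMon_base ψ rfl) _).symm)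

end SigmaScheme

end

/-!
For a homomorphism `φ : R ⟶ Γ(X)`, the composition `α₁(R) → α₁(O_X(1)) → τ'_X(1) = C(X)_cpt`
with `β_X` is a homomorphism `κ` of semirings. It gives a map `f : X → Spec R`, sending `x` to the
prime ideal of all `d` with `x ∈ κ(d)`, such that `f⁻¹ V(d) = κ(d)`. Since restrictions of `O_X`
reflect localization, `φ` followed by restriction to `f⁻¹Z` extends to `R_Z ⟶ O_X(f⁻¹Z)`
(`Spec.fractionMap`). These maps extend from the presheaf `Z ↦ R_Z` to its sheafification: a section
of the structure sheaf is locally a fraction, fractions equal at a point are equal around it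
(`Spec.exists_res_eq`), and so the images of the fractions glue in `O_X` to a unique section
(`Spec.exists_isPulledBack`, `Spec.IsPulledBack.unique`). The compatibility of the resulting
morphism with `β` is local, and on fractions it holds by the construction of `f`
(`Spec.beta_fractionMap`).

Conversely, a morphism `X ⟶ Spec R` induces `R ⟶ Γ(Spec R) ⟶ Γ(X)`, and is determined by it
(`Spec.hom_ext`): compatibility with `β` determines the inverse images of the `V(d)`, hence the map
of spaces, and a map on sections is determined on fractions, hence on `R`. This is the bijection of
the adjunction. It is not needed that `R ⟶ Γ(Spec R)` is an isomorphism.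

The isomorphism `γ` is only assumed to be natural, but the computations of `β` above require that
it carries the localization map `α₁(R) → α₁(R)_{α₂(S)}` to `α₁(R) → α₁(R_S)`. This is automatic
(`SchematizableType.γ_algebraMap`): by naturality, the two maps differ by a natural automorphism of
`α₁`, and comparing `R` with `R_x` shows that this automorphism fixes `α₂(x)`; the elements `α₂(x)`
generate `α₁(R)`.
-/

noncomputable section

namespace SigmaScheme

/-! ### Sheaves of algebras on compact closed sets -/

namespace Alg

variable {σ : AlgType.{u}}

section pullback

variable {P A B C : Alg σ} {f : P ⟶ A} {g : P ⟶ B} {h : A ⟶ C} {k : B ⟶ C}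

/-- The operators on the pairs with equal images under `h` and `k`. -/
def pairsOp (h : A ⟶ C) (k : B ⟶ C) (ω : σ.Op)
    (x : Fin (σ.arity ω) → {x : A.carrier × B.carrier // h x.1 = k x.2}) :
    {x : A.carrier × B.carrier // h x.1 = k x.2} :=
  ⟨(A.op ω fun i => (x i).1.1, B.op ω fun i => (x i).1.2), by
    rw [Alg.map_op, Alg.map_op]
    exact congrArg _ (funext fun i => (x i).2)⟩

/-- The algebra of pairs with equal images under `h` and `k`. -/
def pairs (h : A ⟶ C) (k : B ⟶ C) : Alg σ where
  carrier := {x : A.carrier × B.carrier // h x.1 = k x.2}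
  op := pairsOp h k
  ident e he x := by
    refine Subtype.ext (Prod.ext ?_ ?_)
    · have key := fun t => Term.map_eval (op := pairsOp h k) (op' := A.op)
        (f := fun z => z.1.1) (fun _ _ => rfl) x t
      exact (key e.1).trans ((A.ident e he _).trans (key e.2).symm)
    · have key := fun t => Term.map_eval (op := pairsOp h k) (op' := B.op)
        (f := fun z => z.1.2) (fun _ _ => rfl) x t
      exact (key e.1).trans ((B.ident e he _).trans (key e.2).symm)

/-- The first projection from the algebra of pairs. -/
def pairsFst (h : A ⟶ C) (k : B ⟶ C) : pairs h k ⟶ A where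
  toFun x := x.1.1
  map_op _ _ := rfl

/-- The second projection from the algebra of pairs. -/
def pairsSnd (h : A ⟶ C) (k : B ⟶ C) : pairs h k ⟶ B where
  toFun x := x.1.2
  map_op _ _ := rfl

theorem pairs_condition (h : A ⟶ C) (k : B ⟶ C) : pairsFst h k ≫ h = pairsSnd h k ≫ k :=
  Alg.hom_ext fun x => x.2

theorem exists_of_isPullback (H : IsPullback f g h k) {a : A.carrier} {b : B.carrier}
    (hab : h a = k b) : ∃ p, f p = a ∧ g p = b := by
  have e := pairs_condition h k
  exact ⟨H.lift _ _ e ⟨(a, b), hab⟩,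
    congrArg (fun t => AlgHom.toFun t (⟨(a, b), hab⟩ : (pairs h k).carrier)) (H.lift_fst _ _ e),
    congrArg (fun t => AlgHom.toFun t (⟨(a, b), hab⟩ : (pairs h k).carrier)) (H.lift_snd _ _ e)⟩

theorem ext_of_isPullback (H : IsPullback f g h k) {p q : P.carrier} (h₁ : f p = f q)
    (h₂ : g p = g q) : p = q := by
  have e := pairs_condition h k
  have comm : ∀ x, h (f x) = k (g x) := fun x => congrArg (fun t => AlgHom.toFun t x) H.w
  let j : P ⟶ pairs h k := ⟨fun x => ⟨(f x, g x), comm x⟩, fun ω x =>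
    Subtype.ext (Prod.ext (Alg.map_op f ω x) (Alg.map_op g ω x))⟩
  have hj : j ≫ H.lift _ _ e = 𝟙 P := H.hom_ext
    ((Category.assoc _ _ _).trans ((congrArg (fun t => j ≫ t) (H.lift_fst _ _ e)).trans
      (Category.id_comp f).symm))
    ((Category.assoc _ _ _).trans ((congrArg (fun t => j ≫ t) (H.lift_snd _ _ e)).trans
      (Category.id_comp g).symm))
  have hpq : j p = j q := Subtype.ext (Prod.ext h₁ h₂)
  calc p = (j ≫ H.lift _ _ e) p := (congrArg (fun t => AlgHom.toFun t p) hj).symm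
    _ = (j ≫ H.lift _ _ e) q := congrArg (H.lift _ _ e).toFun hpq
    _ = q := congrArg (fun t => AlgHom.toFun t q) hj

end pullback

theorem eq_of_isTerminal {T : Alg σ} (hT : Limits.IsTerminal T) (x y : T.carrier) : x = y := by
  let pt : Alg σ := ⟨PUnit, fun _ _ => PUnit.unit, fun _ _ _ => rfl⟩
  let j : T ⟶ pt := ⟨fun _ => PUnit.unit, fun _ _ => rfl⟩
  have hj : j ≫ hT.from pt = 𝟙 T := hT.hom_ext _ _
  exact (congrArg (fun t => AlgHom.toFun t x) hj).symm.trans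
    (congrArg (fun t => AlgHom.toFun t y) hj)

end Alg

section sheaf

variable {X : Type u} [TopologicalSpace X] {σ : AlgType.{u}}
  (F : (CptClosed X)ᵒᵖ ⥤ Alg σ)

/-- The restriction map of a presheaf of algebras from `Z` to `W ≤ Z`. -/
abbrev restr {Z W : CptClosed X} (h : W ≤ Z) : F.obj (op Z) ⟶ F.obj (op W) :=
  F.map (homOfLE h).op

theorem restr_restr {Z W U : CptClosed X} (h : W ≤ Z) (h' : U ≤ W)
    (t : (F.obj (op Z)).carrier) :
    restr F h' (restr F h t) = restr F (h'.trans h) t :=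
  (congrArg (fun f => AlgHom.toFun f t) (F.map_comp (homOfLE h).op (homOfLE h').op)).symm

theorem restr_self {Z : CptClosed X} (t : (F.obj (op Z)).carrier) :
    restr F le_rfl t = t :=
  congrArg (fun f => AlgHom.toFun f t) (F.map_id (op Z))

variable {F}

/-- Induction on the members of a cover: a property of compact closed sets `W ≤ Z` that holds for
`0`, passes to sums, and holds for some neighbourhood of each point outside `Z`, holds for `Z`. -/
theorem CptClosed.induction_on_cover (Z : CptClosed X) (P : ∀ W : CptClosed X, W ≤ Z → Prop)
    (zero : ∀ h, P 0 h)
    (sum : ∀ W₁ W₂ (h₁ : W₁ ≤ Z) (h₂ : W₂ ≤ Z) (h : W₁ + W₂ ≤ Z), P W₁ h₁ → P W₂ h₂ →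
      P (W₁ + W₂) h)
    (loc : ∀ x ∉ Z.carrier, ∃ (W : CptClosed X) (h : W ≤ Z), x ∉ W.carrier ∧ P W h) :
    P Z le_rfl := by
  have key : ∃ (W : CptClosed X) (h : W ≤ Z), Z.carrierᶜ ⊆ W.carrierᶜ ∧ P W h := by
    refine Z.isCompact_compl.induction_on
      (p := fun S => ∃ (W : CptClosed X) (h : W ≤ Z), S ⊆ W.carrierᶜ ∧ P W h) ?_ ?_ ?_ ?_
    · exact ⟨0, Set.subset_univ _, Set.empty_subset _, zero _⟩
    · rintro S T hST ⟨W, h, hW, hP⟩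
      exact ⟨W, h, hST.trans hW, hP⟩
    · rintro S T ⟨W₁, h₁, hS, hP₁⟩ ⟨W₂, h₂, hT, hP₂⟩
      have h : W₁ + W₂ ≤ Z := Set.subset_inter h₁ h₂
      refine ⟨W₁ + W₂, h, ?_, sum W₁ W₂ h₁ h₂ h hP₁ hP₂⟩
      rintro x (hx | hx) hx'
      · exact hS hx hx'.1
      · exact hT hx hx'.2
    · intro x hx
      obtain ⟨W, h, hxW, hP⟩ := loc x hx
      exact ⟨W.carrierᶜ, mem_nhdsWithin_of_mem_nhds (W.isClosed.isOpen_compl.mem_nhds hxW), W, h,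
        subset_rfl, hP⟩
  obtain ⟨W, h, hW, hP⟩ := key
  obtain rfl : W = Z := le_antisymm h (Set.compl_subset_compl.1 hW)
  exact hP

variable [SpectralSpace X]

/-- Sections of a sheaf that agree around every point are equal. -/
theorem IsSheafCpt.ext (hF : IsSheafCpt F) {Z : CptClosed X} {t t' : (F.obj (op Z)).carrier}
    (h : ∀ x ∉ Z.carrier, ∃ (W : CptClosed X) (hW : W ≤ Z), x ∉ W.carrier ∧
      restr F hW t = restr F hW t') : t = t' := by
  have := CptClosed.induction_on_cover Z (fun W hW => restr F hW t = restr F hW t')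
    (fun _ => Alg.eq_of_isTerminal hF.1.some _ _) (fun W₁ W₂ h₁ h₂ h e₁ e₂ => ?_) h
  · rwa [restr_self, restr_self] at this
  · refine Alg.ext_of_isPullback (hF.2 W₁ W₂) ?_ ?_
    · exact (restr_restr F h _ t).trans (e₁.trans (restr_restr F h _ t').symm)
    · exact (restr_restr F h _ t).trans (e₂.trans (restr_restr F h _ t').symm)

/-- Two sections of a sheaf that agree on the intersection glue. -/
theorem IsSheafCpt.exists_glue (hF : IsSheafCpt F) {W₁ W₂ : CptClosed X}
    (t₁ : (F.obj (op W₁)).carrier) (t₂ : (F.obj (op W₂)).carrier)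
    (h : restr F (CptClosed.mul_le_left W₁ W₂) t₁ = restr F (CptClosed.mul_le_right W₁ W₂) t₂) :
    ∃ t : (F.obj (op (W₁ + W₂))).carrier, restr F (CptClosed.le_add_left W₁ W₂) t = t₁ ∧
      restr F (CptClosed.le_add_right W₁ W₂) t = t₂ :=
  Alg.exists_of_isPullback (hF.2 W₁ W₂) h

end sheaf

/-! ### The comparison of localizations and the localization maps -/

namespace SchematizableType

variable (𝒜 : SchematizableType.{u})

/-- The canonical map `R_S ⟶ R`, for the trivial submonoid `S = {1}`. -/
def locBot (R : Alg 𝒜.σ.toAlgType) : Loc R (⊥ : Submonoid R.carrier) ⟶ R :=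
  Loc.lift (𝟙 R) fun s hs => by
    rw [Submonoid.mem_bot.1 hs]
    exact isUnit_one

/-- The natural automorphism of `α₁(R)` that `γ` gives for the trivial submonoid. -/
def twist (R : Alg 𝒜.σ.toAlgType) : (𝒜.α₁.obj R).carrier →+* (𝒜.α₁.obj R).carrier :=
  ((PIIRng.hom (𝒜.α₁.map (𝒜.locBot R))).comp (𝒜.γ R ⊥).toRingHom).comp (algebraMap _ _)

theorem map_ι_twist {R : Alg 𝒜.σ.toAlgType} (S : Submonoid R.carrier)
    (d : (𝒜.α₁.obj R).carrier) :
    PIIRng.hom (𝒜.α₁.map (Loc.ι R S)) (𝒜.twist R d) = 𝒜.γ R S (algebraMap _ _ d) := by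
  have hbot : ∀ s ∈ (⊥ : Submonoid R.carrier), (𝟙 R : R ⟶ R) s ∈ S := fun s hs => by
    rw [Submonoid.mem_bot.1 hs]
    exact S.one_mem
  have h1 := 𝒜.γ_natural (𝟙 R) hbot (by
    rintro _ ⟨x, hx, rfl⟩
    rw [𝒜.α₂_natural]
    exact ⟨x, hbot x hx, rfl⟩) (algebraMap (𝒜.α₁.obj R).carrier _ d)
  rw [locMap_algebraMap, 𝒜.α₁.map_id] at h1
  refine Eq.trans ?_ h1
  have e : 𝒜.locBot R ≫ Loc.ι R S = Loc.map (𝟙 R) hbot := Loc.hom_ext fun _ => rfl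
  exact congrArg (fun t => PIIRng.hom t (𝒜.γ R ⊥ (algebraMap _ _ d)))
    ((𝒜.α₁.map_comp _ _).symm.trans (congrArg 𝒜.α₁.map e))

theorem map_twist {A B : Alg 𝒜.σ.toAlgType} (f : A ⟶ B) (d : (𝒜.α₁.obj A).carrier) :
    PIIRng.hom (𝒜.α₁.map f) (𝒜.twist A d) = 𝒜.twist B (PIIRng.hom (𝒜.α₁.map f) d) := by
  have hbot : ∀ s ∈ (⊥ : Submonoid A.carrier), f s ∈ (⊥ : Submonoid B.carrier) := fun s hs => by
    rw [Submonoid.mem_bot.1 hs]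
    exact map_one (Alg.toMonoidHom f)
  have h1 := 𝒜.γ_natural f hbot (by
    rintro _ ⟨x, hx, rfl⟩
    rw [𝒜.α₂_natural]
    exact ⟨f x, hbot x hx, rfl⟩) (algebraMap (𝒜.α₁.obj A).carrier _ d)
  rw [locMap_algebraMap] at h1
  refine Eq.trans ?_ (congrArg (PIIRng.hom (𝒜.α₁.map (𝒜.locBot B))) h1)
  have e : 𝒜.locBot A ≫ f = Loc.map f hbot ≫ 𝒜.locBot B := Loc.hom_ext fun _ => rfl
  exact congrArg (fun t => PIIRng.hom t (𝒜.γ A ⊥ (algebraMap _ _ d)))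
    ((𝒜.α₁.map_comp _ _).symm.trans ((congrArg 𝒜.α₁.map e).trans (𝒜.α₁.map_comp _ _)))

theorem twist_bijective (R : Alg 𝒜.σ.toAlgType) : Function.Bijective (𝒜.twist R) := by
  have h1 : Function.Bijective (algebraMap (𝒜.α₁.obj R).carrier
      (Localization ((⊥ : Submonoid R.carrier).map (𝒜.α₂ R)))) := by
    refine ⟨fun d e hde => ?_, IsPIIRng.algebraMap_surjective _⟩
    obtain ⟨⟨_, x, hx, rfl⟩, hc⟩ := (IsLocalization.eq_iff_exists
      ((⊥ : Submonoid R.carrier).map (𝒜.α₂ R)) _).1 hde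
    have hc' : 𝒜.α₂ R x * d = 𝒜.α₂ R x * e := hc
    rwa [Submonoid.mem_bot.1 hx, map_one, one_mul, one_mul] at hc'
  have h2 : Function.Bijective (PIIRng.hom (𝒜.α₁.map (𝒜.locBot R))) := by
    have e1 : 𝒜.locBot R ≫ Loc.ι R ⊥ = 𝟙 _ := Loc.hom_ext fun _ => rfl
    have e2 : Loc.ι R ⊥ ≫ 𝒜.locBot R = 𝟙 _ := rfl
    refine Function.bijective_iff_has_inverse.2 ⟨PIIRng.hom (𝒜.α₁.map (Loc.ι R ⊥)),
      fun d => ?_, fun d => ?_⟩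
    · exact congrArg (fun t => PIIRng.hom t d)
        ((𝒜.α₁.map_comp _ _).symm.trans ((congrArg 𝒜.α₁.map e1).trans (𝒜.α₁.map_id _)))
    · exact congrArg (fun t => PIIRng.hom t d)
        ((𝒜.α₁.map_comp _ _).symm.trans ((congrArg 𝒜.α₁.map e2).trans (𝒜.α₁.map_id _)))
  exact (h2.comp (𝒜.γ R ⊥).bijective).comp h1

theorem α₂_eq_one_of_isUnit {R : Alg 𝒜.σ.toAlgType} {x : R.carrier} (hx : IsUnit x) :
    𝒜.α₂ R x = 1 :=
  IsPIIRng.eq_one_of_isUnit (hx.map (𝒜.α₂ R))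

/-- The localization `R_x` sees an element `d` of `α₁(R)` as `1`, after the twist, only if
`α₂(x) ≤ d`. -/
theorem mul_eq_of_map_ι_twist_eq_one {R : Alg 𝒜.σ.toAlgType} (x : R.carrier)
    (d : (𝒜.α₁.obj R).carrier)
    (h : PIIRng.hom (𝒜.α₁.map (Loc.ι R (Submonoid.powers x))) (𝒜.twist R d) = 1) :
    𝒜.α₂ R x * d = 𝒜.α₂ R x := by
  rw [map_ι_twist, map_eq_one_iff (𝒜.γ R (Submonoid.powers x)) (RingEquiv.injective _),
    ← map_one (algebraMap (𝒜.α₁.obj R).carrier _)] at h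
  obtain ⟨⟨_, _, ⟨n, rfl⟩, rfl⟩, hc⟩ := (IsLocalization.eq_iff_exists
    ((Submonoid.powers x).map (𝒜.α₂ R)) _).1 h
  have hc' : 𝒜.α₂ R (x ^ n) * d = 𝒜.α₂ R (x ^ n) := hc.trans (mul_one _)
  have hn : 𝒜.α₂ R x * 𝒜.α₂ R (x ^ n) = 𝒜.α₂ R x := by
    rw [map_pow, ← pow_succ']
    exact IsIdempotentElem.pow_succ_eq n (IsPIIRng.mul_self _)
  rw [← hn, mul_assoc, hc']

/-- The twist fixes `α₂(x)`: in `R_x` the elements `α₂(x)`, its image and its preimage under the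
twist all become `1`, so that `α₂(x)` lies below the image and below the preimage. -/
theorem twist_α₂ {R : Alg 𝒜.σ.toAlgType} (x : R.carrier) :
    𝒜.twist R (𝒜.α₂ R x) = 𝒜.α₂ R x := by
  have h1 : PIIRng.hom (𝒜.α₁.map (Loc.ι R (Submonoid.powers x))) (𝒜.α₂ R x) = 1 := by
    rw [𝒜.α₂_natural]
    exact 𝒜.α₂_eq_one_of_isUnit (Loc.isUnit_ι (Submonoid.mem_powers x))
  have h2 := 𝒜.mul_eq_of_map_ι_twist_eq_one x (𝒜.twist R (𝒜.α₂ R x)) (by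
    rw [map_twist, map_twist, h1, map_one, map_one])
  obtain ⟨e, he⟩ := (𝒜.twist_bijective R).2 (𝒜.α₂ R x)
  have h3 := congrArg (𝒜.twist R) (𝒜.mul_eq_of_map_ι_twist_eq_one x e (by rw [he, h1]))
  rw [map_mul, he] at h3
  rw [← h3, mul_comm, h2]

theorem ringHom_ext {𝒜 : SchematizableType.{u}} (h𝒜 : 𝒜.WeakPatching) {R : Alg 𝒜.σ.toAlgType}
    {D : Type w} [NonAssocSemiring D] {f g : (𝒜.α₁.obj R).carrier →+* D}
    (h : ∀ x, f (𝒜.α₂ R x) = g (𝒜.α₂ R x)) : f = g :=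
  RingHom.eq_of_eqOn_sdense (h𝒜.generates R) (by rintro _ ⟨x, rfl⟩; exact h x)

/-- The isomorphism `γ` carries the localization map of `α₁(R)` to the image under `α₁` of the
localization map of `R`. -/
theorem γ_algebraMap {𝒜 : SchematizableType.{u}} (h𝒜 : 𝒜.WeakPatching) {R : Alg 𝒜.σ.toAlgType}
    (S : Submonoid R.carrier) (d : (𝒜.α₁.obj R).carrier) :
    𝒜.γ R S (algebraMap _ _ d) = PIIRng.hom (𝒜.α₁.map (Loc.ι R S)) d := by
  have h : 𝒜.twist R = RingHom.id _ := ringHom_ext h𝒜 𝒜.twist_α₂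
  rw [← map_ι_twist, h, RingHom.id_apply]

theorem map_ι_surjective {𝒜 : SchematizableType.{u}} (h𝒜 : 𝒜.WeakPatching)
    {R : Alg 𝒜.σ.toAlgType} (S : Submonoid R.carrier) :
    Function.Surjective (PIIRng.hom (𝒜.α₁.map (Loc.ι R S))) := fun y => by
  obtain ⟨d, hd⟩ := IsPIIRng.algebraMap_surjective _ ((𝒜.γ R S).symm y)
  exact ⟨d, by rw [← γ_algebraMap h𝒜, hd, RingEquiv.apply_symm_apply]⟩

end SchematizableType

/-! ### Reduced products and germs -/

namespace Alg

section reducedProduct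

variable {σ : AlgType.{u}} {J : Type u} (l : Filter J) (A : J → Alg σ)

/-- The operators on the product of the `A j` modulo equality eventually along `l`. -/
def reducedProductOp (ω : σ.Op)
    (x : Fin (σ.arity ω) → Quotient (l.productSetoid fun j => (A j).carrier)) :
    Quotient (l.productSetoid fun j => (A j).carrier) :=
  Quotient.mk _ fun j => (A j).op ω fun i => (x i).out j

theorem reducedProductOp_mk (ω : σ.Op) (x : Fin (σ.arity ω) → ∀ j, (A j).carrier) :
    reducedProductOp l A ω (fun i => Quotient.mk _ (x i)) =
      Quotient.mk _ fun j => (A j).op ω fun i => x i j := by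
  have h : ∀ i, ∀ᶠ j in l, (Quotient.mk (l.productSetoid fun j => (A j).carrier) (x i)).out j =
      x i j := fun i => Quotient.exact (s := l.productSetoid fun j => (A j).carrier)
        (Quotient.out_eq (Quotient.mk _ (x i)))
  refine Quotient.sound ((Filter.eventually_all.2 h).mono fun j hj => ?_)
  exact congrArg _ (funext hj)

theorem eval_reducedProductOp_mk {V : Type v} (x : V → ∀ j, (A j).carrier)
    (t : Term σ.toOpSet V) :
    t.eval (reducedProductOp l A) (fun i => Quotient.mk _ (x i)) =
      Quotient.mk _ fun j => t.eval (A j).op fun i => x i j := by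
  induction t with
  | var i => rfl
  | app ω t ih => simp only [Term.eval, ih, reducedProductOp_mk]

/-- The product of the algebras `A j`, modulo equality eventually along the filter `l`. -/
def reducedProduct : Alg σ where
  carrier := Quotient (l.productSetoid fun j => (A j).carrier)
  op := reducedProductOp l A
  ident e he x := by
    have hx : x = fun i => Quotient.mk _ (x i).out := funext fun i => (Quotient.out_eq _).symm
    rw [hx, eval_reducedProductOp_mk, eval_reducedProductOp_mk]
    exact congrArg _ (funext fun j => (A j).ident e he _)

/-- The class of a family of elements in the reduced product. -/
def reducedProduct.mk (f : ∀ j, (A j).carrier) : (reducedProduct l A).carrier :=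
  Quotient.mk _ f

/-- A family of maps to the `A j`, each identity of homomorphisms holding eventually along `l`,
gives a homomorphism to the reduced product. -/
def toReducedProduct {B : Alg σ} (f : ∀ j, B.carrier → (A j).carrier)
    (h : ∀ ω x, ∀ᶠ j in l, f j (B.op ω x) = (A j).op ω fun i => f j (x i)) :
    B ⟶ reducedProduct l A where
  toFun b := reducedProduct.mk l A fun j => f j b
  map_op ω x := (Quotient.sound (h ω x)).trans
    (reducedProductOp_mk l A ω fun i j => f j (x i)).symm

end reducedProduct

theorem reducedProduct_mk_mul_mk {σ : MonAlgType.{u}} {J : Type u} (l : Filter J)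
    (A : J → Alg σ.toAlgType) (f g : ∀ j, (A j).carrier) :
    reducedProduct.mk l A f * reducedProduct.mk l A g =
      reducedProduct.mk l A fun j => f j * g j := by
  have h := eval_reducedProductOp_mk l A ![f, g] σ.mulTerm
  refine Eq.trans ?_ (h.trans ?_)
  · rw [mul_def]
    change σ.mulTerm.eval (reducedProductOp l A) _ = _
    congr 1
    funext i
    fin_cases i <;> rfl
  · refine congrArg _ (funext fun j => ?_)
    rw [mul_def]
    congr 1
    funext i
    fin_cases i <;> rfl

theorem reducedProduct_one {σ : MonAlgType.{u}} {J : Type u} (l : Filter J)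
    (A : J → Alg σ.toAlgType) :
    (1 : (reducedProduct l A).carrier) = reducedProduct.mk l A fun _ => 1 := by
  have h := eval_reducedProductOp_mk l A (fun i : Fin 0 => i.elim0) σ.oneTerm
  refine Eq.trans ?_ (h.trans ?_)
  · rw [one_def]
    change σ.oneTerm.eval (reducedProductOp l A) _ = _
    congr 1
    funext i
    exact i.elim0
  · refine congrArg _ (funext fun j => ?_)
    rw [one_def]
    congr 1
    funext i
    exact i.elim0

end Alg

/-- The filter on compact closed sets generated by the sets of all `U ≤ W`, for `W` not
containing `p`. -/
def CptClosed.awayFilter {X : Type u} [TopologicalSpace X] [SpectralSpace X] (p : X) :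
    Filter (CptClosed X) where
  sets := {S | ∃ W : CptClosed X, p ∉ W.carrier ∧ ∀ U ≤ W, U ∈ S}
  univ_sets := ⟨1, fun h => h, fun _ _ => trivial⟩
  sets_of_superset := fun ⟨W, hp, hW⟩ hST => ⟨W, hp, fun U hU => hST (hW U hU)⟩
  inter_sets := fun ⟨W, hp, hW⟩ ⟨W', hp', hW'⟩ => ⟨W * W', fun h => h.elim hp hp', fun U hU =>
    ⟨hW U (hU.trans (mul_le_left _ _)), hW' U (hU.trans (mul_le_right _ _))⟩⟩

theorem CptClosed.eventually_awayFilter {X : Type u} [TopologicalSpace X] [SpectralSpace X]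
    {p : X} {P : CptClosed X → Prop} :
    (∀ᶠ W in awayFilter p, P W) ↔ ∃ W : CptClosed X, p ∉ W.carrier ∧ ∀ U ≤ W, P U := Iff.rfl

namespace Spec

variable {𝒜 : SchematizableType.{u}} {R : Alg 𝒜.σ.toAlgType}

/-- The germs at `p` of families of elements of the algebras `R_W`. -/
abbrev germProduct (p : Space R) : Alg 𝒜.σ.toAlgType :=
  Alg.reducedProduct (CptClosed.awayFilter p) fun W => Loc R (secMon W)

/-- The map from `R` to germs at `p` of families of elements of the algebras `R_W`. -/
def toGermProduct (p : Space R) : R ⟶ germProduct p :=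
  Alg.toReducedProduct _ _ (fun W => Loc.ι R (secMon W)) fun ω x =>
    Filter.Eventually.of_forall fun _ => Alg.map_op _ ω x

theorem isUnit_toGermProduct {p : Space R} {x : R.carrier} (hx : x ∈ stalkMon p) :
    IsUnit (toGermProduct p x) := by
  classical
  -- The inverse of `x` exists in `R_W` as soon as `W ≤ V(α₂(x))`; other values do not matter.
  let y : (germProduct p).carrier := Alg.reducedProduct.mk _ _ fun W =>
    if h : x ∈ secMon W then Loc.inv ⟨x, h⟩ else 1
  refine IsUnit.of_mul_eq_one y ?_
  refine (Alg.reducedProduct_mk_mul_mk _ _ _ _).trans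
    (Eq.trans ?_ (Alg.reducedProduct_one _ _).symm)
  refine Quotient.sound (CptClosed.eventually_awayFilter.2
    ⟨V (𝒜.α₂ R x), fun h => hx ((mem_V _ _).1 h), fun W hW => ?_⟩)
  have hxW : x ∈ secMon W := hW
  simp only [dif_pos hxW]
  exact Loc.ι_mul_inv (⟨x, hxW⟩ : secMon W)

/-- Elements of `R_Z` with the same image in `R_p` agree in `R_W` for some `W ≤ Z` not containing
`p`: the elements of the system that defines `R_p` become invertible in the germs at `p`, so that
the map from `R_Z` to germs factors through `R_p`. -/
theorem exists_res_eq {Z : CptClosed (Space R)} {p : Space R} (hp : p ∉ Z.carrier)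
    {b b' : (Loc R (secMon Z)).carrier} (h : germ hp b = germ hp b') :
    ∃ (W : CptClosed (Space R)) (hW : W ≤ Z), p ∉ W.carrier ∧
      Loc.res (secMon_mono hW) b = Loc.res (secMon_mono hW) b' := by
  classical
  have hle : ∀ᶠ W in CptClosed.awayFilter p, W ≤ Z :=
    CptClosed.eventually_awayFilter.2 ⟨Z, hp, fun _ h => h⟩
  let j : Loc R (secMon Z) ⟶ germProduct p := Alg.toReducedProduct _ _
    (fun W b => if hW : W ≤ Z then Loc.res (secMon_mono hW) b else 1) fun ω x =>
      hle.mono fun W hW => by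
        simp only [dif_pos hW]
        exact Alg.map_op _ ω x
  have hj : j = germ hp ≫ Loc.lift (toGermProduct p) fun s hs => isUnit_toGermProduct hs := by
    refine Loc.hom_ext fun a => Quotient.sound (hle.mono fun W hW => ?_)
    exact dif_pos hW
  have hb : j b = j b' := by
    rw [hj]
    exact congrArg (AlgHom.toFun (Loc.lift (toGermProduct p) _)) h
  obtain ⟨W, hpW, hW⟩ := CptClosed.eventually_awayFilter.1 (Quotient.exact hb)
  refine ⟨Z * W, CptClosed.mul_le_left _ _, fun h => h.elim hp hpW, ?_⟩
  have h1 := hW (Z * W) (CptClosed.mul_le_right _ _)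
  simpa only [dif_pos (CptClosed.mul_le_left Z W)] using h1

end Spec

/-! ### The map to the spectrum given by a homomorphism to the global sections -/

namespace CptClosed

variable {X : Type u} [TopologicalSpace X] [SpectralSpace X]

theorem le_one (Z : CptClosed X) : Z ≤ 1 := Set.empty_subset _

variable {D : Type u} [CommSemiring D] (κ : D →+* CptClosed X)

/-- The map from `X` to the prime spectrum of `D` given by a homomorphism `κ` from `D` to the
compact closed sets of `X`: the prime ideal of `x` consists of the `d` with `x ∈ κ(d)`. -/
def toPrimeSpectrum (x : X) : PrimeSpectrum D where
  asIdeal :=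
    { carrier := {d | x ∈ (κ d).carrier}
      add_mem' := fun {a b} ha hb => by
        rw [Set.mem_ofPred_eq, map_add]
        exact ⟨ha, hb⟩
      zero_mem' := by
        rw [Set.mem_ofPred_eq, map_zero]
        exact Set.mem_univ x
      smul_mem' := fun c d hd => by
        rw [Set.mem_ofPred_eq, smul_eq_mul, map_mul]
        exact Or.inr hd }
  isPrime := by
    refine Ideal.isPrime_iff.2 ⟨(Ideal.ne_top_iff_one _).2 fun h => ?_, fun {a b} h => ?_⟩
    · have h' : x ∈ (κ 1).carrier := h
      rw [map_one] at h'
      exact h'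
    · have h' : x ∈ (κ (a * b)).carrier := h
      rw [map_mul] at h'
      exact h'

theorem mem_toPrimeSpectrum (x : X) (d : D) :
    d ∈ (toPrimeSpectrum κ x).asIdeal ↔ x ∈ (κ d).carrier := Iff.rfl

theorem preimage_basicOpen_toPrimeSpectrum (d : D) :
    toPrimeSpectrum κ ⁻¹' (PrimeSpectrum.basicOpen d) = (κ d).carrierᶜ := rfl

theorem isSpectralMap_toPrimeSpectrum : IsSpectralMap (toPrimeSpectrum κ) where
  toContinuous := by
    refine PrimeSpectrum.isTopologicalBasis_basic_opens.continuous_iff.2 ?_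
    rintro _ ⟨d, rfl⟩
    rw [preimage_basicOpen_toPrimeSpectrum]
    exact (κ d).isClosed.isOpen_compl
  isCompact_preimage_of_isOpen s hs hs' := by
    obtain ⟨t, rfl⟩ := PrimeSpectrum.isCompact_isOpen_iff.1 ⟨hs', hs⟩
    have h : toPrimeSpectrum κ ⁻¹' (PrimeSpectrum.zeroLocus (t : Set D))ᶜ =
        ⋃ d ∈ t, (κ d).carrierᶜ := by
      ext x
      simp only [Set.mem_preimage, Set.mem_compl_iff, PrimeSpectrum.mem_zeroLocus, Set.mem_iUnion,
        Set.not_subset, SetLike.mem_coe, mem_toPrimeSpectrum, exists_prop]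
    rw [h]
    exact t.isCompact_biUnion fun d _ => (κ d).isCompact_compl

end CptClosed

theorem toTau_one_bijective {X : Type u} [TopologicalSpace X] [SpectralSpace X] :
    Function.Bijective (toTau (op (1 : CptClosed X))) :=
  ⟨fun K K' h => by simpa only [mul_one] using toTau_eq_iff.1 h, toTau_surjective _⟩

theorem LE_map {D D' : Type u} [CommSemiring D] [CommSemiring D'] (f : D →+* D') {a b : D}
    (h : IsPIIRng.LE a b) : IsPIIRng.LE (f a) (f b) :=
  (map_add f a b).symm.trans (congrArg f h)

/-- Over the scheme `X`, a section `a` over `Z` with `β(α₂(a)) ≥ W` becomes invertible over `W`. -/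
theorem Scheme.isUnit_restr {𝒜 : SchematizableType.{u}} (X : Scheme 𝒜)
    {Z W : CptClosed X.carrier} (h : W ≤ Z) (a : (X.O.obj (op Z)).carrier)
    (ha : IsPIIRng.LE (toTau (op Z) W) (PIIRng.hom (X.β.app (op Z)) (𝒜.α₂ (X.O.obj (op Z)) a))) :
    IsUnit (restr X.O h a) := by
  obtain ⟨g, hg⟩ := X.reflects Z W h a ha
  rw [restr, ← hg]
  exact (Loc.isUnit_ι (Submonoid.mem_powers a)).map (Alg.toMonoidHom g)

namespace Spec

variable {𝒜 : SchematizableType.{u}} {X : Scheme 𝒜} {R : Alg 𝒜.σ.toAlgType}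
  (φ : R ⟶ X.O.obj (op 1))

/-- The homomorphism `α₁(R) → α₁(O_X(1)) → τ'_X(1) = C(X)_cpt` given by `φ` and `β_X`. -/
def toCptClosed : (𝒜.α₁.obj R).carrier →+* CptClosed X.carrier :=
  ((RingEquiv.ofBijective (toTau (op (1 : CptClosed X.carrier)))
    toTau_one_bijective).symm.toRingHom.comp (PIIRng.hom (X.β.app (op 1)))).comp
      (PIIRng.hom (𝒜.α₁.map φ))

theorem toTau_toCptClosed (d : (𝒜.α₁.obj R).carrier) :
    toTau (op 1) (toCptClosed φ d) =
      PIIRng.hom (X.β.app (op 1)) (PIIRng.hom (𝒜.α₁.map φ) d) :=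
  (RingEquiv.ofBijective (toTau (op (1 : CptClosed X.carrier)))
    toTau_one_bijective).apply_symm_apply _

/-- The map `X → Spec R` given by `φ : R ⟶ Γ(X)`. -/
def transposeBase : X.carrier → Space R := CptClosed.toPrimeSpectrum (toCptClosed φ)

theorem isSpectralMap_transposeBase : IsSpectralMap (transposeBase φ) :=
  CptClosed.isSpectralMap_toPrimeSpectrum _

/-- The inverse image of a compact closed set under `X → Spec R`. -/
abbrev pull (Z : CptClosed (Space R)) : CptClosed X.carrier :=
  CptClosed.comap (isSpectralMap_transposeBase φ) Z

theorem pull_mono {Z W : CptClosed (Space R)} (h : W ≤ Z) : pull φ W ≤ pull φ Z :=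
  CptClosed.comap_mono _ h

theorem pull_V (d : (𝒜.α₁.obj R).carrier) : pull φ (V d) = toCptClosed φ d :=
  CptClosed.ext (Set.ext fun _ => mem_V d _)

/-- The homomorphism `R_Z ⟶ O_X(f⁻¹Z)` induced by `φ`, where `f : X → Spec R` is the map given
by `φ`. -/
def fractionMap (Z : CptClosed (Space R)) : Loc R (secMon Z) ⟶ X.O.obj (op (pull φ Z)) :=
  Loc.lift (φ ≫ restr X.O (CptClosed.le_one (pull φ Z))) fun s hs => by
    refine X.isUnit_restr (CptClosed.le_one (pull φ Z)) (φ s) ?_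
    rw [← 𝒜.α₂_natural, ← toTau_toCptClosed, ← pull_V]
    exact LE_map _ (CptClosed.le_iff.1 (pull_mono φ hs))

theorem ι_fractionMap (Z : CptClosed (Space R)) :
    Loc.ι R (secMon Z) ≫ fractionMap φ Z = φ ≫ restr X.O (CptClosed.le_one (pull φ Z)) := rfl

theorem restr_fractionMap {Z W : CptClosed (Space R)} (h : W ≤ Z)
    (b : (Loc R (secMon Z)).carrier) :
    restr X.O (pull_mono φ h) (fractionMap φ Z b) =
      fractionMap φ W (Loc.res (secMon_mono h) b) := by
  have e : fractionMap φ Z ≫ restr X.O (pull_mono φ h) =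
      Loc.res (secMon_mono h) ≫ fractionMap φ W := Loc.hom_ext fun a =>
    restr_restr X.O (CptClosed.le_one (pull φ Z)) (pull_mono φ h) (φ a)
  exact congrArg (fun t => AlgHom.toFun t b) e

/-- A section `t` of `O_X` over `f⁻¹Z` is the inverse image of the section `s` of the structure
sheaf of `Spec R` over `Z` if both are locally given by the same fractions. -/
def IsPulledBack (Z : CptClosed (Space R)) (s : (sections Z).carrier)
    (t : (X.O.obj (op (pull φ Z))).carrier) : Prop :=
  ∀ p ∉ Z.carrier, ∃ (U : CptClosed (Space R)) (hU : U ≤ Z), p ∉ U.carrier ∧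
    ∃ b : (Loc R (secMon U)).carrier,
      (∀ (q : Space R) (hq : q ∉ U.carrier), ev (fun h => hq (hU h)) s = germ hq b) ∧
      restr X.O (pull_mono φ hU) t = fractionMap φ U b

variable {φ}

theorem isPulledBack_restr {Z W : CptClosed (Space R)} (h : W ≤ Z) {s : (sections Z).carrier}
    {t : (X.O.obj (op (pull φ Z))).carrier} (hst : IsPulledBack φ Z s t) :
    IsPulledBack φ W (restr (structureSheaf R) h s)
      (restr X.O (pull_mono φ h) t) := fun p hp => by
  obtain ⟨U, hU, hpU, b, hb, htb⟩ := hst p fun h' => hp (h h')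
  refine ⟨W * U, CptClosed.mul_le_left _ _, fun h' => h'.elim hp hpU,
    Loc.res (secMon_mono (CptClosed.mul_le_right _ _)) b, fun q hq => ?_, ?_⟩
  · rw [germ_res (CptClosed.mul_le_right _ _)]
    exact hb q _
  · rw [restr_restr, ← restr_fractionMap φ (CptClosed.mul_le_right W U), ← htb,
      restr_restr]

theorem isPulledBack_fractionMap {Z : CptClosed (Space R)} (b : (Loc R (secMon Z)).carrier) :
    IsPulledBack φ Z ((toStructureSheaf R).app (op Z) b) (fractionMap φ Z b) := fun _ hp =>
  ⟨Z, le_rfl, hp, b, fun _ _ => rfl, restr_self _ _⟩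

/-- Two inverse images of a section are locally given by fractions with the same germs, which agree
on a smaller neighbourhood. -/
theorem IsPulledBack.unique {Z : CptClosed (Space R)} {s : (sections Z).carrier}
    {t t' : (X.O.obj (op (pull φ Z))).carrier} (h : IsPulledBack φ Z s t)
    (h' : IsPulledBack φ Z s t') : t = t' := by
  refine X.isSheaf.ext fun x hx => ?_
  obtain ⟨U, hU, hpU, b, hb, htb⟩ := h (transposeBase φ x) hx
  obtain ⟨U', hU', hpU', b', hb', htb'⟩ := h' (transposeBase φ x) hx
  have hp : transposeBase φ x ∉ (U * U').carrier := fun h => h.elim hpU hpU'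
  obtain ⟨W, hW, hpW, hbb'⟩ := exists_res_eq hp
    (b := Loc.res (secMon_mono (CptClosed.mul_le_left _ _)) b)
    (b' := Loc.res (secMon_mono (CptClosed.mul_le_right _ _)) b') (by
      rw [germ_res (CptClosed.mul_le_left _ _), germ_res (CptClosed.mul_le_right _ _), ← hb, ← hb'])
  have key : ∀ {T : CptClosed (Space R)} (hT : T ≤ Z) (hUT : U * U' ≤ T)
      {r : (X.O.obj (op (pull φ Z))).carrier} {c : (Loc R (secMon T)).carrier},
      restr X.O (pull_mono φ hT) r = fractionMap φ T c →
        restr X.O (pull_mono φ ((hW.trans hUT).trans hT)) r =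
          fractionMap φ W (Loc.res (secMon_mono hW) (Loc.res (secMon_mono hUT) c)) := by
    intro T hT hUT r c hr
    rw [← restr_fractionMap φ hW, ← restr_fractionMap φ hUT, ← hr, restr_restr, restr_restr]
  have hU₁ := CptClosed.mul_le_left U U'
  have hU₂ := CptClosed.mul_le_right U U'
  exact ⟨pull φ W, pull_mono φ ((hW.trans hU₁).trans hU), hpW, (key hU hU₁ htb).trans
    ((congrArg (fractionMap φ W).toFun hbb').trans (key hU' hU₂ htb').symm)⟩

theorem isPulledBack_op {Z : CptClosed (Space R)} (ω : 𝒜.σ.Op)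
    {s : Fin (𝒜.σ.arity ω) → (sections Z).carrier}
    {t : Fin (𝒜.σ.arity ω) → (X.O.obj (op (pull φ Z))).carrier}
    (h : ∀ i, IsPulledBack φ Z (s i) (t i)) :
    IsPulledBack φ Z ((sections Z).op ω s) ((X.O.obj (op (pull φ Z))).op ω t) := fun p hp => by
  choose W hW hpW b hb htb using fun i => h i p hp
  obtain ⟨U, hUZ, hpU, hU⟩ := CptClosed.exists_le_of_finite Z W p hp hpW
  refine ⟨U, hUZ, hpU, (Loc R (secMon U)).op ω fun i => Loc.res (secMon_mono (hU i)) (b i),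
    fun q hq => ?_, ?_⟩
  · rw [Alg.map_op, Alg.map_op]
    refine congrArg _ (funext fun i => ?_)
    rw [germ_res (hU i)]
    exact hb i q _
  · rw [Alg.map_op, Alg.map_op]
    refine congrArg _ (funext fun i => ?_)
    rw [← restr_fractionMap φ (hU i), ← htb, restr_restr]

/-- Every section has an inverse image: locally it is a fraction, whose image is given by `φ`, and
the local inverse images glue because they are unique. -/
theorem exists_isPulledBack {Z : CptClosed (Space R)} (s : (sections Z).carrier) :
    ∃ t, IsPulledBack φ Z s t := by
  have h := CptClosed.induction_on_cover Z
    (fun W hW => ∃ t, IsPulledBack φ W (restr (structureSheaf R) hW s) t) ?_ ?_ ?_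
  · exact h
  -- Over `0` the condition on `t` is empty, and any section will do.
  · exact fun _ => ⟨1, fun p hp => absurd (Set.mem_univ p) hp⟩
  · rintro W₁ W₂ h₁ h₂ h ⟨t₁, ht₁⟩ ⟨t₂, ht₂⟩
    have e : restr X.O (CptClosed.mul_le_left (pull φ W₁) (pull φ W₂)) t₁ =
        restr X.O (CptClosed.mul_le_right (pull φ W₁) (pull φ W₂)) t₂ :=
      (isPulledBack_restr (CptClosed.mul_le_left W₁ W₂) ht₁).unique
        (isPulledBack_restr (CptClosed.mul_le_right W₁ W₂) ht₂)
    obtain ⟨t, rfl, rfl⟩ := X.isSheaf.exists_glue t₁ t₂ e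
    refine ⟨t, fun p hp => ?_⟩
    by_cases hp₁ : p ∈ W₁.carrier
    · obtain ⟨U, hU, hpU, b, hb, htb⟩ := ht₂ p fun hp₂ => hp ⟨hp₁, hp₂⟩
      exact ⟨U, hU.trans (CptClosed.le_add_right _ _), hpU, b, hb,
        (restr_restr X.O _ (pull_mono φ hU) t).symm.trans htb⟩
    · obtain ⟨U, hU, hpU, b, hb, htb⟩ := ht₁ p hp₁
      exact ⟨U, hU.trans (CptClosed.le_add_left _ _), hpU, b, hb,
        (restr_restr X.O _ (pull_mono φ hU) t).symm.trans htb⟩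
  · intro p hp
    obtain ⟨W, hW, hpW, b, hb⟩ := s.2 ⟨p, hp⟩
    refine ⟨W, hW, hpW, fractionMap φ W b, ?_⟩
    have e : restr (structureSheaf R) hW s = (toStructureSheaf R).app (op W) b :=
      sections_ext fun q hq => hb q hq
    rw [e]
    exact isPulledBack_fractionMap b

end Spec

/-! ### The morphism of schemes given by a homomorphism to the global sections -/

/-- Sections of `τ'_X` that agree around every point are equal. -/
theorem tau_ext {X : Type u} [TopologicalSpace X] [SpectralSpace X] {Z : CptClosed X}
    {a b : ((tau X).obj (op Z)).carrier}
    (h : ∀ x ∉ Z.carrier, ∃ (W : CptClosed X) (hW : W ≤ Z), x ∉ W.carrier ∧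
      PIIRng.hom ((tau X).map (homOfLE hW).op) a = PIIRng.hom ((tau X).map (homOfLE hW).op) b) :
    a = b := by
  obtain ⟨K, rfl⟩ := toTau_surjective _ a
  obtain ⟨K', rfl⟩ := toTau_surjective _ b
  refine toTau_eq_iff.2 (CptClosed.ext (Set.ext fun x => or_congr_left' fun hx => ?_))
  obtain ⟨W, hW, hxW, e⟩ := h x hx
  rw [tau_map_toTau, tau_map_toTau, toTau_eq_iff] at e
  have h3 : (x ∈ K.carrier ∨ x ∈ W.carrier) ↔ (x ∈ K'.carrier ∨ x ∈ W.carrier) :=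
    iff_of_eq (congrArg (fun t : CptClosed X => x ∈ t.carrier) e)
  rwa [or_iff_left hxW, or_iff_left hxW] at h3

namespace Spec

variable {𝒜 : SchematizableType.{u}} {X : Scheme 𝒜} {R : Alg 𝒜.σ.toAlgType}
  (φ : R ⟶ X.O.obj (op 1))

/-- The morphism of sheaves from the structure sheaf of `Spec R` to `f_* O_X` given by `φ`. -/
def transposeSharp : structureSheaf R ⟶
    (CptClosed.comapFunctor (isSpectralMap_transposeBase φ)).op ⋙ X.O where
  app Z :=
    { toFun := fun s => (exists_isPulledBack (φ := φ) (Z := Z.unop) s).choose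
      map_op := fun ω s => (exists_isPulledBack _).choose_spec.unique
        (isPulledBack_op ω fun i => (exists_isPulledBack (s i)).choose_spec) }
  naturality _ _ h := Alg.hom_ext fun s => (exists_isPulledBack _).choose_spec.unique
    (isPulledBack_restr (leOfHom h.unop) (exists_isPulledBack (φ := φ) s).choose_spec)

variable {φ} in
theorem transposeSharp_eq {Z : CptClosed (Space R)} {s : (sections Z).carrier}
    {t : (X.O.obj (op (pull φ Z))).carrier} (h : IsPulledBack φ Z s t) :
    (transposeSharp φ).app (op Z) s = t :=
  (exists_isPulledBack s).choose_spec.unique h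

/-- The morphism given by `φ` is compatible with `β` on fractions: as `α₁(R) → α₁(R_U)` is surjective,
it suffices to consider `d ∈ α₁(R)`, for which both sides are the class of `f⁻¹ V(d)`. -/
theorem beta_fractionMap (h𝒜 : 𝒜.WeakPatching) (U : CptClosed (Space R))
    (y : (𝒜.α₁.obj (Loc R (secMon U))).carrier) :
    PIIRng.hom ((tauMap (isSpectralMap_transposeBase φ)).app (op U))
        (PIIRng.hom ((beta h𝒜 R).app (op U))
          (PIIRng.hom (𝒜.α₁.map ((toStructureSheaf R).app (op U))) y)) =
      PIIRng.hom (X.β.app (op (pull φ U))) (PIIRng.hom (𝒜.α₁.map (fractionMap φ U)) y) := by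
  obtain ⟨d, rfl⟩ := SchematizableType.map_ι_surjective h𝒜 (secMon U) y
  rw [beta_toStructureSheaf h𝒜 R (op U) _ d (by
    rw [← SchematizableType.γ_algebraMap h𝒜]
    exact RingEquiv.symm_apply_apply _ _), tauMap_toTau]
  change toTau (op (pull φ U)) (pull φ (V d)) = _
  have e1 : 𝒜.α₁.map (Loc.ι R (secMon U)) ≫ 𝒜.α₁.map (fractionMap φ U) =
      𝒜.α₁.map φ ≫ 𝒜.α₁.map (restr X.O (CptClosed.le_one (pull φ U))) :=
    (𝒜.α₁.map_comp _ _).symm.trans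
      ((congrArg 𝒜.α₁.map (ι_fractionMap φ U)).trans (𝒜.α₁.map_comp _ _))
  have e2 := congrArg (fun t => PIIRng.hom t (PIIRng.hom (𝒜.α₁.map φ) d))
    (X.β.naturality (homOfLE (CptClosed.le_one (pull φ U))).op)
  refine Eq.trans ?_ (congrArg (fun t => PIIRng.hom (X.β.app (op (pull φ U)))
    (PIIRng.hom t d)) e1).symm
  refine Eq.trans ?_ e2.symm
  change _ = PIIRng.hom ((tau X.carrier).map (homOfLE (CptClosed.le_one (pull φ U))).op)
    (PIIRng.hom (X.β.app (op 1)) (PIIRng.hom (𝒜.α₁.map φ) d))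
  rw [← toTau_toCptClosed, tau_map_toTau, pull_V]

/-- The morphism of `𝒜`-schemes `X ⟶ Spec R` given by a homomorphism `R ⟶ Γ(X)`. -/
def transpose (h𝒜 : 𝒜.WeakPatching) : X ⟶ obj h𝒜 R where
  base := transposeBase φ
  isSpectralMap := isSpectralMap_transposeBase φ
  sharp := transposeSharp φ
  comm Z := SchematizableType.ringHom_ext h𝒜 fun s => by
    refine tau_ext fun x hx => ?_
    obtain ⟨U, hU, hpU, b, hb, htb⟩ :=
      (exists_isPulledBack (φ := φ) (Z := Z.unop) s).choose_spec (transposeBase φ x) hx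
    refine ⟨pull φ U, pull_mono φ hU, hpU, ?_⟩
    have e1 := congrArg (fun t => PIIRng.hom t (𝒜.α₂ (sections Z.unop) s))
      (((beta h𝒜 R) ≫ (tauMap (isSpectralMap_transposeBase φ))).naturality (homOfLE hU).op)
    have e2 := congrArg (fun t => PIIRng.hom t (𝒜.α₂ (sections Z.unop) s))
      ((Functor.whiskerRight (transposeSharp φ) 𝒜.α₁ ≫ Functor.whiskerLeft
        (CptClosed.comapFunctor (isSpectralMap_transposeBase φ)).op X.β).naturality
          (homOfLE hU).op)
    refine e1.symm.trans (Eq.trans ?_ e2)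
    have hs : restr (structureSheaf R) hU s = (toStructureSheaf R).app (op U) b :=
      sections_ext fun q hq => hb q hq
    have e3 : PIIRng.hom (𝒜.α₁.map (restr (structureSheaf R) hU)) (𝒜.α₂ (sections Z.unop) s) =
        PIIRng.hom (𝒜.α₁.map ((toStructureSheaf R).app (op U))) (𝒜.α₂ _ b) :=
      (𝒜.α₂_natural (restr (structureSheaf R) hU) s).trans
        ((congrArg (𝒜.α₂ (sections U)) hs).trans
          (𝒜.α₂_natural ((toStructureSheaf R).app (op U)) b).symm)
    have e4 : (toStructureSheaf R).app (op U) ≫ (transposeSharp φ).app (op U) =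
        fractionMap φ U := Alg.hom_ext fun b =>
      transposeSharp_eq (isPulledBack_fractionMap b)
    have e5 := (𝒜.α₁.map_comp _ _).symm.trans (congrArg 𝒜.α₁.map e4)
    refine Eq.trans (congrArg (fun t => PIIRng.hom
      ((tauMap (isSpectralMap_transposeBase φ)).app (op U))
        (PIIRng.hom ((beta h𝒜 R).app (op U)) t)) e3) ?_
    refine Eq.trans ?_ (congrArg (fun t => PIIRng.hom (X.β.app (op (pull φ U)))
      (PIIRng.hom (𝒜.α₁.map ((transposeSharp φ).app (op U))) t)) e3).symm
    refine (beta_fractionMap φ h𝒜 U _).trans ?_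
    exact (congrArg (fun t => PIIRng.hom (X.β.app (op (pull φ U)))
      (PIIRng.hom t (𝒜.α₂ _ b))) e5).symm

/-- The canonical homomorphism from `R` to the global sections of its spectrum. -/
def unit (R : Alg 𝒜.σ.toAlgType) : R ⟶ (structureSheaf R).obj (op 1) :=
  Loc.ι R (secMon 1) ≫ (toStructureSheaf R).app (op 1)

theorem unit_transpose (h𝒜 : 𝒜.WeakPatching) :
    unit R ≫ (transpose φ h𝒜).sharp.app (op 1) = φ := Alg.hom_ext fun a =>
  (transposeSharp_eq (isPulledBack_fractionMap (Loc.ι R (secMon 1) a))).trans (restr_self X.O _)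

/-- A morphism from the structure sheaf of `Spec R` to a direct image of `O_X` is determined by its
composition with `R ⟶ Γ(Spec R)`. -/
theorem sharp_ext {f : X.carrier → Space R} (hf : IsSpectralMap f)
    {s s' : structureSheaf R ⟶ (CptClosed.comapFunctor hf).op ⋙ X.O}
    (h : unit R ≫ s.app (op 1) = unit R ≫ s'.app (op 1)) : s = s' := by
  have key : ∀ U : CptClosed (Space R), (toStructureSheaf R).app (op U) ≫ s.app (op U) =
      (toStructureSheaf R).app (op U) ≫ s'.app (op U) := fun U => Loc.hom_ext fun a => by
    have e := fun r : structureSheaf R ⟶ (CptClosed.comapFunctor hf).op ⋙ X.O =>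
      congrArg (fun t => AlgHom.toFun t (unit R a))
        (r.naturality (homOfLE (CptClosed.le_one U)).op)
    refine (e s).trans (Eq.trans ?_ (e s').symm)
    exact congrArg (((CptClosed.comapFunctor hf).op ⋙ X.O).map
      (homOfLE (CptClosed.le_one U)).op).toFun (congrArg (fun t => AlgHom.toFun t a) h)
  ext Z : 2
  refine Alg.hom_ext fun z => X.isSheaf.ext fun x hx => ?_
  obtain ⟨U, hU, hpU, b, hb⟩ := z.2 ⟨f x, hx⟩
  refine ⟨CptClosed.comap hf U, CptClosed.comap_mono hf hU, hpU, ?_⟩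
  have hz : restr (structureSheaf R) hU z = (toStructureSheaf R).app (op U) b :=
    sections_ext fun q hq => hb q hq
  have e := fun r : structureSheaf R ⟶ (CptClosed.comapFunctor hf).op ⋙ X.O =>
    (congrArg (fun t => AlgHom.toFun t z) (r.naturality (homOfLE hU).op)).symm.trans
      (congrArg (r.app (op U)).toFun hz)
  exact (e s).trans ((congrArg (fun t => AlgHom.toFun t b) (key U)).trans (e s').symm)

theorem toTau_comap_V (h𝒜 : 𝒜.WeakPatching) (f : Scheme.Hom X (obj h𝒜 R))
    (d : (𝒜.α₁.obj R).carrier) :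
    toTau (op 1) (CptClosed.comap f.isSpectralMap (V d)) =
      PIIRng.hom (X.β.app (op 1)) (PIIRng.hom (𝒜.α₁.map (unit R ≫ f.sharp.app (op 1))) d) := by
  have h1 := beta_toStructureSheaf h𝒜 R (op 1)
    (PIIRng.hom (𝒜.α₁.map (Loc.ι R (secMon 1))) d) d (by
      rw [← SchematizableType.γ_algebraMap h𝒜]
      exact RingEquiv.symm_apply_apply _ _)
  have e1 := congrArg (fun t => PIIRng.hom t d)
    (𝒜.α₁.map_comp (Loc.ι R (secMon 1)) ((toStructureSheaf R).app (op 1)))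
  have e2 := congrArg (fun t => PIIRng.hom t (PIIRng.hom (𝒜.α₁.map (unit R)) d)) (f.comm (op 1))
  have e3 := congrArg (fun t => PIIRng.hom (X.β.app (op 1)) (PIIRng.hom t d))
    (𝒜.α₁.map_comp (unit R) (f.sharp.app (op 1)))
  refine (tauMap_toTau f.isSpectralMap (op 1) (V d)).symm.trans (Eq.trans ?_ (e2.trans e3.symm))
  exact congrArg (PIIRng.hom ((tauMap f.isSpectralMap).app (op 1)))
    (h1.symm.trans (congrArg (PIIRng.hom ((beta h𝒜 R).app (op 1))) e1.symm))

/-- A morphism to `Spec R` is determined by the homomorphism from `R` to the global sections that it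
induces: the compatibility with `β` determines the inverse images of the sets `V(d)`, and hence the
map of spaces. -/
theorem hom_ext (h𝒜 : 𝒜.WeakPatching) {f g : Scheme.Hom X (obj h𝒜 R)}
    (h : unit R ≫ f.sharp.app (op 1) = unit R ≫ g.sharp.app (op 1)) : f = g := by
  have hV : ∀ d : (𝒜.α₁.obj R).carrier,
      CptClosed.comap f.isSpectralMap (V d) = CptClosed.comap g.isSpectralMap (V d) := fun d =>
    toTau_one_bijective.1 ((toTau_comap_V h𝒜 f d).trans ((congrArg (fun t =>
      PIIRng.hom (X.β.app (op 1)) (PIIRng.hom (𝒜.α₁.map t) d)) h).trans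
        (toTau_comap_V h𝒜 g d).symm))
  have hb : f.base = g.base := funext fun x => PrimeSpectrum.ext (Ideal.ext fun d => by
    have h1 : x ∈ (CptClosed.comap f.isSpectralMap (V d)).carrier ↔
        x ∈ (CptClosed.comap g.isSpectralMap (V d)).carrier := by rw [hV d]
    exact (mem_V d (f.base x)).symm.trans (h1.trans (mem_V d (g.base x))))
  obtain ⟨f, hf, f', hfc⟩ := f
  obtain ⟨g, hg, g', hgc⟩ := g
  obtain rfl : f = g := hb
  obtain rfl : f' = g' := sharp_ext hf h
  rfl

theorem unit_naturality {A B : Alg 𝒜.σ.toAlgType} (h𝒜 : 𝒜.WeakPatching) (ψ : B ⟶ A) :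
    unit B ≫ (map h𝒜 ψ).sharp.app (op 1) = ψ ≫ unit A := rfl

/-- Morphisms `X ⟶ Spec R` correspond to homomorphisms `R ⟶ Γ(X)`. -/
def homEquiv (h𝒜 : 𝒜.WeakPatching) (R : Alg 𝒜.σ.toAlgType) (X : (Scheme 𝒜)ᵒᵖ) :
    ((Spec 𝒜 h𝒜).obj R ⟶ X) ≃ (R ⟶ (Scheme.Γ 𝒜).obj X) where
  toFun f := unit R ≫ (Scheme.Γ 𝒜).map f
  invFun φ := Quiver.Hom.op (transpose (X := X.unop) φ h𝒜)
  left_inv _ := Quiver.Hom.unop_inj (hom_ext h𝒜 (unit_transpose _ h𝒜))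
  right_inv φ := unit_transpose (X := X.unop) φ h𝒜

/-- The spectrum functor is left adjoint to the global section functor. -/
def adjunction (h𝒜 : 𝒜.WeakPatching) : Spec 𝒜 h𝒜 ⊣ Scheme.Γ 𝒜 :=
  Adjunction.mkOfHomEquiv
    { homEquiv := homEquiv h𝒜
      homEquiv_naturality_left_symm := fun {A B X} ψ g => by
        refine (Equiv.symm_apply_eq _).2 ?_
        refine Eq.symm ((congrArg (fun t => unit A ≫ t) ((Scheme.Γ 𝒜).map_comp _ _)).trans ?_)
        refine (Category.assoc _ _ _).symm.trans ?_
        refine (congrArg (fun t => t ≫ _) (unit_naturality h𝒜 ψ)).trans ?_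
        refine (Category.assoc _ _ _).trans ?_
        exact congrArg (fun t => ψ ≫ t) ((homEquiv h𝒜 B X).apply_symm_apply g)
      homEquiv_naturality_right := fun f g =>
        (congrArg (fun t => unit _ ≫ t) ((Scheme.Γ 𝒜).map_comp f g)).trans
          (Category.assoc _ _ _).symm }

end Spec

end SigmaScheme

end

theorem mainTheorem1 (𝒜 : SigmaScheme.SchematizableType.{u}) (h𝒜 : 𝒜.WeakPatching) :
    Nonempty (SigmaScheme.Spec 𝒜 h𝒜 ⊣ SigmaScheme.Scheme.Γ 𝒜) :=
  ⟨SigmaScheme.Spec.adjunction h𝒜⟩
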